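/- Let $n$ be a natural number, let $\mathcal D$ be the set of dyads, i.e. of unordered pairs $ij$ of distinct elements of $\{1,\dots,n\}$, and let $P$ be a probability distribution on $\{0,1\}^{\mathcal D}$ (the distribution of a random network $X=(X_{d})_{d\in\mathcal D}$ on $n$ nodes) that is exchangeable, i.e. $P(X_{ij}=x_{ij}\ \forall ij)=P(X_{ij}=x_{\pi(i)\pi(j)}\ \forall ij)$ for all $x\in\{0,1\}^{\mathcal D}$ and all permutations $\pi$ of $\{1,\dots,n\}$. A chain mixed graph with vertex set $\mathcal D$ is a graph with three types of edges, lines $u - v$, arrows $u\to v$ and arcs $u\leftrightarrow v$ (loops and multiple edges are permitted), without semi-directed cycles, i.e. without closed walks that consist of lines and arrows, contain at least one arrow, and have all their arrows pointing in the direction of the walk. A section of a walk is a maximal subwalk consisting only of lines (possibly a single vertex); it is a collider section if the walk has an edge immediately before it and an edge immediately after it, and both of these edges have an arrowhead at the section; otherwise it is a non-collider section. A walk is connecting given $C\subseteq \mathcal D$ if all its collider sections intersect $C$ and all its non-collider sections are disjoint from $C$. For pairwise disjoint $A,B,C\subseteq\mathcal D$, $C$ separates $A$ and $B$ in $G$ if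 no walk between $A$ and $B$ is connecting given $C$. Two graphs are Markov equivalent if the same triples $(A,B,C)$ of pairwise disjoint sets are separated in both. $P$ is faithful to $G$ if, for all pairwise disjoint $A,B,C\subseteq\mathcal D$, $X_A$ and $X_B$ are conditionally independent given $X_C$ under $P$ if and only if $C$ separates $A$ and $B$ in $G$. The incidence graph is the graph with vertex set $\mathcal D$ in which two distinct dyads are adjacent if and only if they share a node; its complement has the same vertex set and the complementary set of edges. The undirected (bidirected) version of such a graph has all its edges lines (arcs). Theorem. If $P$ is faithful to a chain mixed graph $G$ with vertex set $\mathcal D$, then $G$ is Markov equivalent to one of the following graphs on $\mathcal D$: (1) the empty graph; (2) the undirected incidence graph $L_{-}(n)$; (3) the bidirected incidence graph $L_{\leftrightarrow}(n)$; (4) the undirected complement of the incidence graph $L^c_{-}(n)$; (5) the bidirected complement of the incidence graph $L^c_{\leftrightarrow}(n)$; (6) the (undirected) complete graph. -/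

import Mathlib

/-! ### Mixed graphs and chain mixed graphs -/

/-- A mixed graph on the vertex set `V`, with lines `u — v`, arrows `u → v` and arcs `u ↔ v`.
Multiple edges (of different types) and loops are permitted. -/
structure MixedGraph (V : Type*) where
  line : V → V → Prop
  arrow : V → V → Prop
  arc : V → V → Prop
  line_symm : ∀ u v, line u v → line v u
  arc_symm : ∀ u v, arc u v → arc v u

/-- The way in which a walk can traverse an edge when going from `u` to `v`:
`u — v`, `u → v`, `u ← v` or `u ↔ v`. -/
inductive EdgeKind where
  | line
  | forward
  | backward
  | arc

/-- The traversed edge has an arrowhead at the vertex that the walk leaves. -/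
def EdgeKind.HeadAtStart : EdgeKind → Prop
  | .line => False
  | .forward => False
  | .backward => True
  | .arc => True

/-- The traversed edge has an arrowhead at the vertex that the walk enters. -/
def EdgeKind.HeadAtEnd : EdgeKind → Prop
  | .line => False
  | .forward => True
  | .backward => False
  | .arc => True

namespace MixedGraph

/-- A chain mixed graph is a mixed graph without semi-directed cycles: following lines and
arrows in their direction, one can never return to the tail of an arrow from its head. -/
def IsChain {V : Type*} (G : MixedGraph V) : Prop :=
  ∀ u v, G.arrow u v → ¬ Relation.ReflTransGen (fun a b => G.line a b ∨ G.arrow a b) v u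

/-- `G` has an edge that is traversed as kind `k` when going from `u` to `v`. -/
def HasEdge {V : Type*} (G : MixedGraph V) : EdgeKind → V → V → Prop
  | .line, u, v => G.line u v
  | .forward, u, v => G.arrow u v
  | .backward, u, v => G.arrow v u
  | .arc, u, v => G.arc u v

/-- A walk `vert 0, kind 0, vert 1, …, kind (length - 1), vert length` in `G`. The values of
`vert` beyond `length` and of `kind` from `length` on are irrelevant. -/
structure Walk {V : Type*} (G : MixedGraph V) where
  length : ℕ
  vert : ℕ → V
  kind : ℕ → EdgeKind
  valid : ∀ m, m < length → G.HasEdge (kind m) (vert m) (vert (m + 1))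

namespace Walk

/-- The subwalk from position `s` to position `t` is a section: a maximal subwalk
all of whose edges are lines (possibly a single vertex). -/
def IsSection {V : Type*} {G : MixedGraph V} (w : G.Walk) (s t : ℕ) : Prop :=
  s ≤ t ∧ t ≤ w.length ∧ (∀ m, s ≤ m → m < t → w.kind m = EdgeKind.line) ∧
    (∀ m, m + 1 = s → w.kind m ≠ EdgeKind.line) ∧
    (t < w.length → w.kind t ≠ EdgeKind.line)

/-- The section from `s` to `t` is a collider section: on both sides it is preceded,
respectively followed, by an edge of the walk with an arrowhead at the section. -/
def IsCollider {V : Type*} {G : MixedGraph V} (w : G.Walk) (s t : ℕ) : Prop :=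
  (∃ m, m + 1 = s ∧ (w.kind m).HeadAtEnd) ∧ t < w.length ∧ (w.kind t).HeadAtStart

/-- The walk is connecting given `C`: all collider sections intersect `C`, and all
non-collider sections are disjoint from `C`. -/
def IsConnecting {V : Type*} {G : MixedGraph V} (w : G.Walk) (C : Set V) : Prop :=
  ∀ s t, w.IsSection s t →
    (w.IsCollider s t → ∃ m, s ≤ m ∧ m ≤ t ∧ w.vert m ∈ C) ∧
    (¬ w.IsCollider s t → ∀ m, s ≤ m → m ≤ t → w.vert m ∉ C)

end Walk

/-- `A` and `B` are separated by `C` in `G`: no walk between `A` and `B` is connecting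
given `C`. -/
def Separated {V : Type*} (G : MixedGraph V) (A B C : Set V) : Prop :=
  ∀ w : G.Walk, w.vert 0 ∈ A → w.vert w.length ∈ B → ¬ w.IsConnecting C

/-- Two graphs are Markov equivalent if they induce the same independence model. -/
def MarkovEquivalent {V : Type*} (G H : MixedGraph V) : Prop :=
  ∀ A B C : Set V, Disjoint A B → Disjoint A C → Disjoint B C →
    (G.Separated A B C ↔ H.Separated A B C)

/-- The undirected graph (all edges are lines) with skeleton `H`. -/
def undirected {V : Type*} (H : SimpleGraph V) : MixedGraph V where
  line := H.Adj
  arrow _ _ := False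
  arc _ _ := False
  line_symm _ _ h := h.symm
  arc_symm _ _ h := h

/-- The bidirected graph (all edges are arcs) with skeleton `H`. -/
def bidirected {V : Type*} (H : SimpleGraph V) : MixedGraph V where
  line _ _ := False
  arrow _ _ := False
  arc := H.Adj
  line_symm _ _ h := h
  arc_symm _ _ h := h.symm

end MixedGraph

/-! ### Conditional independence and faithfulness -/

/-- Conditional independence of `X_A` and `X_B` given `X_C` for a vector `X` of binary random
variables indexed by `V` with joint distribution `P`: for all events `X_A ∈ S` and for
`P`-almost all values `b` of `X_B` and `c` of `X_C`, i.e. for those with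
`P(X_B = b, X_C = c) ≠ 0`,
`P(X_A ∈ S | X_B = b, X_C = c) = P(X_A ∈ S | X_C = c)`. -/
def CondIndependent {V : Type*} (P : MeasureTheory.Measure (V → Bool)) (A B C : Set V) : Prop :=
  ∀ (S : Set (A → Bool)) (b : B → Bool) (c : C → Bool),
    P ({x | B.domRestrict x = b} ∩ {x | C.domRestrict x = c}) ≠ 0 →
      ProbabilityTheory.cond P ({x | B.domRestrict x = b} ∩ {x | C.domRestrict x = c})
          {x | A.domRestrict x ∈ S} =
        ProbabilityTheory.cond P {x | C.domRestrict x = c} {x | A.domRestrict x ∈ S}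

/-- `P` and `G` are faithful: the independence model of `P` is the one induced by `G`. -/
def IsFaithful {V : Type*} (P : MeasureTheory.Measure (V → Bool)) (G : MixedGraph V) : Prop :=
  ∀ A B C : Set V, Disjoint A B → Disjoint A C → Disjoint B C →
    (G.Separated A B C ↔ CondIndependent P A B C)

/-! ### Random networks -/

/-- The dyads `ij` of a network on `n` nodes: the unordered pairs of distinct nodes, that is,
the edges of the complete graph on the nodes. -/
abbrev Dyad (n : ℕ) : Type := (⊤ : SimpleGraph (Fin n)).edgeSet

/-- The dyad `π(i)π(j)` for a dyad `ij`. -/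
def Dyad.relabel {n : ℕ} (π : Equiv.Perm (Fin n)) (d : Dyad n) : Dyad n :=
  (SimpleGraph.Iso.completeGraph π).mapEdgeSet d

/-- The distribution `P` of a random network on `n` nodes is exchangeable: it is invariant under
relabelling of the nodes. -/
def IsExchangeable {n : ℕ} (P : MeasureTheory.Measure (Dyad n → Bool)) : Prop :=
  ∀ (π : Equiv.Perm (Fin n)) (x : Dyad n → Bool), P {x} = P {fun d => x (d.relabel π)}

/-- The incidence graph on `n` nodes: the line graph of the complete graph. -/
abbrev incidenceGraph (n : ℕ) : SimpleGraph (Dyad n) := (⊤ : SimpleGraph (Fin n)).lineGraph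

/-! Exchangeability and faithfulness enter through one consequence only: separation in `G` is
invariant under relabelling of the nodes. Call two dyads inseparable if no set separates them.
Relabellings act transitively on the pairs of dyads sharing one node and on the pairs of disjoint
dyads, so the graph of inseparable pairs is empty, the incidence graph, its complement, or complete
(`IsInvariant.insepGraph_eq`). What remains is to find the right type of edge on this skeleton.

There are two criteria. If every separable pair is separated by all other vertices, `G` is
equivalent to the undirected graph on its skeleton (`markovEquivalent_undirected`). If `G` has only
arcs, up to loops, it is equivalent to the bidirected one (`markovEquivalent_bidirected`). The empty
and the complete skeleton satisfy the first criterion at once.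

For the other two skeletons consider unshielded triples u, v, w: u, v and v, w inseparable, u, w
separable. By invariance, v lies in some separator of u and w either for all such triples or for
none. If for none: a separable pair is separated by its anterior vertices (`not_conn_anterior`), and
every inseparable pair extends to an unshielded triple, so no vertex is anterior to another one
inseparable from it, and only arcs are left. If for all: v is always anterior to u or w
(`conn_of_adj_component`). Hence the vertices to which a given vertex is anterior form a set closed
under a combinatorial rule, and this rule lets two disjoint maximal components exist only if
together they exhaust the dyads. So some separable pair has every vertex anterior to it and is
separated by all the others; by invariance all separable pairs are. Extending pairs and applying the
rule needs 4 nodes (5 for the complement); with fewer nodes the first criterion holds directly.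

Walks are handled as paths of states, a state being a vertex with the status of its section.
Concatenating, reversing and changing the conditioning set then become arguments about single steps.
-/

/-! ### Connecting walks as paths of states -/

/-- The reason why a section of a connecting walk is harmless: it is a non-collider section with no
arrowhead at its beginning (`left`) or at its end (`right`), or it is a collider section. -/
inductive SectionStatus where
  | left
  | right
  | collider

namespace SectionStatus

/-- The status of a section in the reversed walk. -/
def swap : SectionStatus → SectionStatus
  | .left => .right
  | .right => .left
  | .collider => .collider

/-- A section of the given status may be left along an edge of the given kind. -/
def AllowsExit : SectionStatus → EdgeKind → Prop
  | .left, _ => True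
  | .right, k => ¬ k.HeadAtStart
  | .collider, k => k.HeadAtStart

/-- A section of the given status may be entered along an edge of the given kind. -/
def AllowsEntry : SectionStatus → EdgeKind → Prop
  | .left, k => ¬ k.HeadAtEnd
  | .right, _ => True
  | .collider, k => k.HeadAtEnd

end SectionStatus

/-- The kind of an edge when it is traversed in the opposite direction. -/
def EdgeKind.reverse : EdgeKind → EdgeKind
  | .line => .line
  | .forward => .backward
  | .backward => .forward
  | .arc => .arc

theorem SectionStatus.allowsExit_swap {κ : SectionStatus} {k : EdgeKind} (h : κ.AllowsEntry k) :
    κ.swap.AllowsExit k.reverse := by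
  cases κ <;> cases k <;>
    simp_all [swap, AllowsEntry, AllowsExit, EdgeKind.reverse, EdgeKind.HeadAtStart,
      EdgeKind.HeadAtEnd]

theorem SectionStatus.allowsEntry_swap {κ : SectionStatus} {k : EdgeKind} (h : κ.AllowsExit k) :
    κ.swap.AllowsEntry k.reverse := by
  cases κ <;> cases k <;>
    simp_all [swap, AllowsEntry, AllowsExit, EdgeKind.reverse, EdgeKind.HeadAtStart,
      EdgeKind.HeadAtEnd]

namespace MixedGraph

open Relation SectionStatus

variable {V : Type*} {G : MixedGraph V}

theorem HasEdge.reverse {k : EdgeKind} {u v : V} (h : G.HasEdge k u v) :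
    G.HasEdge k.reverse v u := by
  cases k
  · exact G.line_symm _ _ h
  · exact h
  · exact h
  · exact G.arc_symm _ _ h

/-- `u` and `v` are joined by a walk of lines. -/
def LineConn (G : MixedGraph V) : V → V → Prop := ReflTransGen G.line

theorem LineConn.symm {u v : V} (h : G.LineConn u v) : G.LineConn v u :=
  by
  induction h with
  | refl => exact .refl
  | tail _ h ih => exact .head (G.line_symm _ _ h) ih

theorem LineConn.trans {u v w : V} (h : G.LineConn u v) (h' : G.LineConn v w) : G.LineConn u w :=
  ReflTransGen.trans h h'

theorem LineConn.of_line {u v : V} (h : G.line u v) : G.LineConn u v := ReflTransGen.single h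

/-- A vertex may lie in a section of the given status in a walk that is connecting given `C`. -/
def Admissible (G : MixedGraph V) (C : Set V) (v : V) : SectionStatus → Prop
  | .left => v ∉ C
  | .right => v ∉ C
  | .collider => ∃ c ∈ C, G.LineConn v c

theorem admissible_swap {C : Set V} {v : V} {κ : SectionStatus} :
    G.Admissible C v κ.swap ↔ G.Admissible C v κ := by
  cases κ <;> rfl

/-- One step of a walk that is connecting given `C`, with the statuses of the sections. -/
inductive Step (G : MixedGraph V) (C : Set V) : V × SectionStatus → V × SectionStatus → Prop
  | line {a b : V} {κ : SectionStatus} (h : G.line a b) (ha : G.Admissible C a κ)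
      (hb : G.Admissible C b κ) : Step G C (a, κ) (b, κ)
  | turn {a : V} (ha : a ∉ C) : Step G C (a, left) (a, right)
  | edge {a b : V} {κ κ' : SectionStatus} (k : EdgeKind) (hk : k ≠ .line) (h : G.HasEdge k a b)
      (hx : κ.AllowsExit k) (he : κ'.AllowsEntry k) (ha : G.Admissible C a κ)
      (hb : G.Admissible C b κ') : Step G C (a, κ) (b, κ')

/-- There is a path of states given `C`. -/
abbrev Reach (G : MixedGraph V) (C : Set V) : V × SectionStatus → V × SectionStatus → Prop :=
  ReflTransGen (G.Step C)

/-- `u` and `w` are joined by a walk that is connecting given `C`. -/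
def Conn (G : MixedGraph V) (C : Set V) (u w : V) : Prop := G.Reach C (u, left) (w, right)

variable {C C' : Set V} {u v w a b : V} {κ κ' : SectionStatus}

theorem Step.mono {s t : V × SectionStatus} (h : G.Step C s t)
    (hs : G.Admissible C s.1 s.2 → G.Admissible C' s.1 s.2)
    (ht : G.Admissible C t.1 t.2 → G.Admissible C' t.1 t.2) : G.Step C' s t := by
  cases h with
  | line h ha hb => exact .line h (hs ha) (ht hb)
  | turn ha => exact .turn (hs ha)
  | edge k hk h hx he ha hb => exact .edge k hk h hx he (hs ha) (ht hb)

theorem Step.admissible_left {s t : V × SectionStatus} (h : G.Step C s t) :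
    G.Admissible C s.1 s.2 := by
  cases h <;> assumption

theorem Step.swap (h : G.Step C (a, κ) (b, κ')) : G.Step C (b, κ'.swap) (a, κ.swap) := by
  cases h with
  | line h ha hb =>
    exact .line (G.line_symm _ _ h) (admissible_swap.2 hb) (admissible_swap.2 ha)
  | turn ha => exact .turn ha
  | edge k hk h hx he ha hb =>
    exact .edge k.reverse (by cases k <;> simp_all [EdgeKind.reverse]) h.reverse
      (allowsExit_swap he) (allowsEntry_swap hx) (admissible_swap.2 hb) (admissible_swap.2 ha)

theorem Reach.swap {s t : V × SectionStatus} (h : G.Reach C s t) :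
    G.Reach C (t.1, t.2.swap) (s.1, s.2.swap) := by
  induction h with
  | refl => exact .refl
  | tail _ h ih => exact .head h.swap ih

theorem Conn.symm (h : G.Conn C u w) : G.Conn C w u := Reach.swap h

theorem Conn.notMem_left (h : G.Conn C u w) : u ∉ C := by
  rcases ReflTransGen.cases_head h with h | ⟨s, h, -⟩
  · cases h
  · exact h.admissible_left

theorem Conn.notMem_right (h : G.Conn C u w) : w ∉ C := h.symm.notMem_left

theorem Reach.lines (h : G.LineConn a b) (hκ : ∀ x, G.LineConn a x → G.Admissible C x κ) :
    G.Reach C (a, κ) (b, κ) := by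
  induction h with
  | refl => exact .refl
  | tail h₁ h₂ ih => exact ih.tail (.line h₂ (hκ _ h₁) (hκ _ (h₁.tail h₂)))

theorem Reach.collider_lines (h : G.LineConn a b) (ha : G.Admissible C a collider) :
    G.Reach C (a, collider) (b, collider) := by
  obtain ⟨c, hc, hac⟩ := ha
  exact Reach.lines h fun x hx => ⟨c, hc, hx.symm.trans hac⟩

theorem Conn.of_line (h : G.line u v) (hu : u ∉ C) (hv : v ∉ C) : G.Conn C u v :=
  .head (.line h hu hv) (.single (.turn hv))

theorem Conn.of_edge {k : EdgeKind} (h : G.HasEdge k u v) (hu : u ∉ C) (hv : v ∉ C) :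
    G.Conn C u v := by
  by_cases hk : k = .line
  · subst hk
    exact .of_line h hu hv
  · exact .single (.edge k hk h trivial trivial hu hv)

/-! ### Separation in terms of paths of states -/

namespace Walk

open Classical in
/-- Extension of a walk by an edge. -/
def snoc (w : G.Walk) (k : EdgeKind) (v : V) (h : G.HasEdge k (w.vert w.length) v) : G.Walk where
  length := w.length + 1
  vert i := if i ≤ w.length then w.vert i else v
  kind i := if i < w.length then w.kind i else k
  valid i hi := by
    rcases (Nat.lt_succ_iff.1 hi).lt_or_eq with hi | rfl
    · simpa [hi, hi.le, Nat.succ_le_of_lt hi] using w.valid i hi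
    · simpa using h

theorem exists_isSection (w : G.Walk) {m : ℕ} (hm : m ≤ w.length) :
    ∃ s t, w.IsSection s t ∧ s ≤ m ∧ m ≤ t := by
  have h₁ : ∀ m, ∃ s, s ≤ m ∧ (∀ i, s ≤ i → i < m → w.kind i = .line) ∧
      ∀ i, i + 1 = s → w.kind i ≠ .line := by
    intro m
    induction m with
    | zero => exact ⟨0, le_rfl, by omega, by omega⟩
    | succ m ih =>
      by_cases hk : w.kind m = .line
      · obtain ⟨s, hs, h, h'⟩ := ih
        refine ⟨s, by omega, fun i hi hi' => ?_, h'⟩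
        rcases (Nat.lt_succ_iff.1 hi').lt_or_eq with hi' | rfl
        · exact h i hi hi'
        · exact hk
      · refine ⟨m + 1, le_rfl, by omega, fun i hi => ?_⟩
        obtain rfl : i = m := by omega
        exact hk
  have h₂ : ∀ d m, m + d = w.length → ∃ t, m ≤ t ∧ t ≤ w.length ∧
      (∀ i, m ≤ i → i < t → w.kind i = .line) ∧ (t < w.length → w.kind t ≠ .line) := by
    intro d
    induction d with
    | zero => exact fun m hm => ⟨m, le_rfl, by omega, by omega, by omega⟩
    | succ d ih =>
      intro m hm
      by_cases hk : w.kind m = .line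
      · obtain ⟨t, ht, htl, h, h'⟩ := ih (m + 1) (by omega)
        refine ⟨t, by omega, htl, fun i hi hi' => ?_, h'⟩
        rcases hi.lt_or_eq with hi | rfl
        · exact h i hi hi'
        · exact hk
      · exact ⟨m, le_rfl, by omega, by omega, fun _ => hk⟩
  obtain ⟨s, hs, hs₁, hs₂⟩ := h₁ m
  obtain ⟨t, ht, htl, ht₁, ht₂⟩ := h₂ (w.length - m) m (by omega)
  refine ⟨s, t, ⟨hs.trans ht, htl, fun i hi hi' => ?_, hs₂, ht₂⟩, hs, ht⟩
  rcases lt_or_ge i m with h | h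
  · exact hs₁ i hi h
  · exact ht₁ i h hi'

/-- The status of a section fits to the edges of the walk around it. -/
def HasStatus (w : G.Walk) (s t : ℕ) : SectionStatus → Prop
  | .left => ∀ i, i + 1 = s → ¬ (w.kind i).HeadAtEnd
  | .right => t < w.length → ¬ (w.kind t).HeadAtStart
  | .collider => w.IsCollider s t

theorem HasStatus.not_isCollider {w : G.Walk} {s t : ℕ} (h : w.HasStatus s t κ)
    (hκ : κ ≠ collider) : ¬ w.IsCollider s t := by
  rintro ⟨⟨i, hi, hi'⟩, ht, ht'⟩
  cases κ
  · exact h i hi hi'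
  · exact h ht ht'
  · exact hκ rfl

theorem exists_hasStatus (w : G.Walk) (s t : ℕ) : ∃ κ, w.HasStatus s t κ := by
  by_cases h₁ : ∃ i, i + 1 = s ∧ (w.kind i).HeadAtEnd
  · by_cases h₂ : t < w.length ∧ (w.kind t).HeadAtStart
    · exact ⟨collider, h₁, h₂⟩
    · exact ⟨right, fun h h' => h₂ ⟨h, h'⟩⟩
  · exact ⟨left, fun i hi hi' => h₁ ⟨i, hi, hi'⟩⟩

theorem lineConn_of_section {w : G.Walk} {s t : ℕ} (h : w.IsSection s t) {i j : ℕ} (hi : s ≤ i)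
    (hij : i ≤ j) (hj : j ≤ t) : G.LineConn (w.vert i) (w.vert j) := by
  induction j, hij using Nat.le_induction with
  | base => exact .refl
  | succ j hij ih =>
    refine (ih (by omega)).tail ?_
    have := w.valid j (by have := h.2.1; omega)
    rwa [h.2.2.1 j (by omega) (by omega)] at this

theorem IsConnecting.admissible {w : G.Walk} (hw : w.IsConnecting C) {s t m : ℕ}
    (h : w.IsSection s t) (hs : s ≤ m) (ht : m ≤ t) (hκ : w.HasStatus s t κ) :
    G.Admissible C (w.vert m) κ := by
  by_cases hc : κ = collider
  · subst hc
    obtain ⟨i, hi, hi', hic⟩ := (hw s t h).1 hκ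
    refine ⟨_, hic, ?_⟩
    rcases le_total i m with him | him
    · exact (lineConn_of_section h hi him ht).symm
    · exact lineConn_of_section h hs him hi'
  · have := (hw s t h).2 (hκ.not_isCollider hc) m hs ht
    cases κ <;> first | exact this | exact absurd rfl hc

/-- Induction on the position. Lines stay in the section and keep its status; at any other edge the
previous section ends, and whichever status fits that section permits the exit. -/
theorem IsConnecting.reach {w : G.Walk} (hw : w.IsConnecting C) {m : ℕ} :
    ∀ {s t : ℕ}, w.IsSection s t → s ≤ m → m ≤ t → w.HasStatus s t κ →
      G.Reach C (w.vert 0, left) (w.vert m, κ) := by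
  induction m generalizing κ with
  | zero =>
    intro s t h hs ht hκ
    obtain rfl : s = 0 := by omega
    cases κ with
    | left => exact .refl
    | right =>
      refine .single (.turn (hw.admissible (κ := left) h hs ht ?_))
      intro i hi
      omega
    | collider =>
      obtain ⟨⟨i, hi, -⟩, -⟩ := hκ
      omega
  | succ m ih =>
    intro s t h hs ht hκ
    have hml : m < w.length := by have := h.2.1; omega
    have hv := w.valid m hml
    rcases hs.lt_or_eq with hs' | hs'
    · have hm : w.kind m = .line := h.2.2.1 m (by omega) (by omega)
      rw [hm] at hv
      exact (ih h (by omega) (by omega) hκ).tail (.line hv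
        (hw.admissible h (by omega) (by omega) hκ) (hw.admissible h hs ht hκ))
    · have hm : w.kind m ≠ .line := h.2.2.2.1 m hs'.symm
      obtain ⟨s₀, t₀, h₀, hs₀, ht₀⟩ := w.exists_isSection hml.le
      obtain rfl : t₀ = m := by
        by_contra hne
        exact hm (h₀.2.2.1 m hs₀ (by omega))
      obtain ⟨κ₀, hκ₀⟩ := w.exists_hasStatus s₀ t₀
      refine (ih h₀ hs₀ le_rfl hκ₀).tail (.edge _ hm hv ?_ ?_ (hw.admissible h₀ hs₀ le_rfl hκ₀)
        (hw.admissible h hs ht hκ))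
      · cases κ₀ with
        | left => trivial
        | right => exact hκ₀ hml
        | collider => exact hκ₀.2.2
      · cases κ with
        | left => exact hκ _ hs'.symm
        | right => trivial
        | collider =>
          obtain ⟨⟨i, hi, hi'⟩, -⟩ := hκ
          obtain rfl : i = t₀ := by omega
          exact hi'

theorem IsConnecting.conn {w : G.Walk} (hw : w.IsConnecting C) :
    G.Conn C (w.vert 0) (w.vert w.length) := by
  obtain ⟨s, t, h, hs, ht⟩ := w.exists_isSection le_rfl
  refine hw.reach h hs ht (κ := right) fun h' => ?_
  omega

/-- All sections before the last one are as required for a connecting walk, and the last one is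
so if the walk is continued in accordance with the status `κ`. If `κ` is `collider`, then the last
section needs to intersect `C` only if `M` holds. -/
structure Partial (w : G.Walk) (C : Set V) (κ : SectionStatus) (M : Prop) : Prop where
  before : ∀ s t, w.IsSection s t → t < w.length →
    (w.IsCollider s t → ∃ m, s ≤ m ∧ m ≤ t ∧ w.vert m ∈ C) ∧
      (¬ w.IsCollider s t → ∀ m, s ≤ m → m ≤ t → w.vert m ∉ C)
  last_collider : κ = collider → ∀ s, w.IsSection s w.length →
    (∃ i, i + 1 = s ∧ (w.kind i).HeadAtEnd) ∧ (M → ∃ m, s ≤ m ∧ m ≤ w.length ∧ w.vert m ∈ C)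
  last_left : κ = left → ∀ s, w.IsSection s w.length →
    (∀ i, i + 1 = s → ¬ (w.kind i).HeadAtEnd)
  last_noncollider : κ ≠ collider → ∀ s, w.IsSection s w.length →
    ∀ m, s ≤ m → m ≤ w.length → w.vert m ∉ C

theorem Partial.imp_of_ne {w : G.Walk} {M M' : Prop} (hw : w.Partial C κ M) (hκ : κ ≠ collider) :
    w.Partial C κ M' :=
  ⟨hw.before, fun h => absurd h hκ, hw.last_left, hw.last_noncollider⟩

section Snoc

variable {w : G.Walk} {k : EdgeKind} (h : G.HasEdge k (w.vert w.length) v)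

theorem snoc_length : (w.snoc k v h).length = w.length + 1 := rfl

theorem snoc_vert {i : ℕ} (hi : i ≤ w.length) : (w.snoc k v h).vert i = w.vert i := if_pos hi

theorem snoc_vert_last : (w.snoc k v h).vert (w.length + 1) = v := if_neg (by omega)

theorem snoc_kind {i : ℕ} (hi : i < w.length) : (w.snoc k v h).kind i = w.kind i := if_pos hi

theorem snoc_kind_last : (w.snoc k v h).kind w.length = k := if_neg (by omega)

theorem isSection_snoc_of_lt {s t : ℕ} (ht : t < w.length) :
    (w.snoc k v h).IsSection s t ↔ w.IsSection s t := by
  unfold IsSection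
  refine and_congr_right fun hst => and_congr ?_ (and_congr ?_ (and_congr ?_ ?_))
  · rw [snoc_length]; omega
  · exact forall_congr' fun i => imp_congr_right fun _ => forall_congr' fun hi => by
      rw [snoc_kind h (by omega)]
  · exact forall_congr' fun i => forall_congr' fun hi => by rw [snoc_kind h (by omega)]
  · rw [snoc_kind h ht, snoc_length]
    simp [ht, ht.trans (Nat.lt_succ_self _)]

theorem isCollider_snoc_of_lt {s t : ℕ} (hst : s ≤ t) (ht : t < w.length) :
    (w.snoc k v h).IsCollider s t ↔ w.IsCollider s t := by
  unfold IsCollider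
  refine and_congr (exists_congr fun i => and_congr_right fun hi => ?_) (and_congr ?_ ?_)
  · rw [snoc_kind h (by omega)]
  · rw [snoc_length]; omega
  · rw [snoc_kind h ht]

theorem isSection_of_snoc {s : ℕ} (hs : (w.snoc k v h).IsSection s w.length) :
    w.IsSection s w.length := by
  obtain ⟨h₁, h₂, h₃, h₄, h₅⟩ := hs
  refine ⟨h₁, le_rfl, fun i hi hi' => ?_, fun i hi => ?_, fun h => by omega⟩
  · rw [← snoc_kind h hi']; exact h₃ i hi hi'
  · rw [← snoc_kind h (by omega)]; exact h₄ i hi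

theorem isSection_of_snoc_line (hk : k = .line) {s : ℕ}
    (hs : (w.snoc k v h).IsSection s (w.length + 1)) :
    s ≤ w.length ∧ w.IsSection s w.length := by
  obtain ⟨h₁, h₂, h₃, h₄, h₅⟩ := hs
  have hsl : s ≤ w.length := by
    by_contra hc
    exact h₄ w.length (by omega) (by rw [snoc_kind_last, hk])
  refine ⟨hsl, hsl, le_rfl, fun i hi hi' => ?_, fun i hi => ?_, fun h => by omega⟩
  · rw [← snoc_kind h hi']; exact h₃ i hi (by omega)
  · rw [← snoc_kind h (by omega)]; exact h₄ i hi

theorem eq_of_isSection_snoc (hk : k ≠ .line) {s : ℕ}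
    (hs : (w.snoc k v h).IsSection s (w.length + 1)) : s = w.length + 1 := by
  by_contra hc
  have := hs.1
  exact hk (by rw [← snoc_kind_last h]; exact hs.2.2.1 w.length (by omega) (by omega))

theorem Partial.snoc_line {M M' : Prop} (hw : w.Partial C κ M) (hk : k = .line)
    (hv : κ ≠ collider → v ∉ C) (hM : M' → M ∨ v ∈ C) : (w.snoc k v h).Partial C κ M' := by
  constructor
  · intro s t hst ht
    rw [snoc_length] at ht
    rcases (Nat.lt_succ_iff.1 ht).lt_or_eq with ht' | rfl
    · have hst' := (isSection_snoc_of_lt h ht').1 hst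
      rw [isCollider_snoc_of_lt h hst.1 ht']
      refine ⟨fun hc => ?_, fun hc m hm hm' => ?_⟩
      · obtain ⟨m, hm, hm', hmc⟩ := (hw.before s t hst' ht').1 hc
        exact ⟨m, hm, hm', by rwa [snoc_vert h (by omega)]⟩
      · rw [snoc_vert h (by omega)]
        exact (hw.before s t hst' ht').2 hc m hm hm'
    · exact absurd (by rw [snoc_kind_last, hk]) (hst.2.2.2.2 ht)
  · intro hκ s hs
    obtain ⟨hsl, hs'⟩ := isSection_of_snoc_line h hk hs
    obtain ⟨⟨i, hi, hi'⟩, hc⟩ := hw.last_collider hκ s hs'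
    refine ⟨⟨i, hi, by rwa [snoc_kind h (by omega)]⟩, fun hM' => ?_⟩
    rcases hM hM' with hM' | hvC
    · obtain ⟨m, hm, hm', hmc⟩ := hc hM'
      exact ⟨m, hm, hm'.trans (Nat.le_succ _), by rwa [snoc_vert h hm']⟩
    · exact ⟨w.length + 1, by omega, le_rfl, by rwa [snoc_vert_last]⟩
  · intro hκ s hs i hi
    obtain ⟨hsl, hs'⟩ := isSection_of_snoc_line h hk hs
    rw [snoc_kind h (by omega)]
    exact hw.last_left hκ s hs' i hi
  · intro hκ s hs m hm hm'
    obtain ⟨hsl, hs'⟩ := isSection_of_snoc_line h hk hs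
    rw [snoc_length] at hm'
    rcases hm'.lt_or_eq with hm' | rfl
    · rw [snoc_vert h (by omega)]
      exact hw.last_noncollider hκ s hs' m hm (by omega)
    · rw [snoc_vert_last]
      exact hv hκ

theorem Partial.snoc_edge {M : Prop} (hw : w.Partial C κ True) (hk : k ≠ .line)
    (hx : κ.AllowsExit k) (he : κ'.AllowsEntry k) (hv : κ' ≠ collider → v ∉ C) (hM : M → v ∈ C) :
    (w.snoc k v h).Partial C κ' M := by
  constructor
  · intro s t hst ht
    rw [snoc_length] at ht
    rcases (Nat.lt_succ_iff.1 ht).lt_or_eq with ht' | rfl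
    · have hst' := (isSection_snoc_of_lt h ht').1 hst
      rw [isCollider_snoc_of_lt h hst.1 ht']
      refine ⟨fun hc => ?_, fun hc m hm hm' => ?_⟩
      · obtain ⟨m, hm, hm', hmc⟩ := (hw.before s t hst' ht').1 hc
        exact ⟨m, hm, hm', by rwa [snoc_vert h (by omega)]⟩
      · rw [snoc_vert h (by omega)]
        exact (hw.before s t hst' ht').2 hc m hm hm'
    · have hs := isSection_of_snoc h hst
      have hs₁ := hst.1
      constructor
      · rintro ⟨⟨i, hi, hi'⟩, -, hc⟩
        rw [snoc_kind_last] at hc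
        rw [snoc_kind h (by omega)] at hi'
        cases κ with
        | left => exact absurd hi' (hw.last_left rfl s hs i hi)
        | right => exact absurd hc hx
        | collider =>
          obtain ⟨m, hm, hm', hmc⟩ := (hw.last_collider rfl s hs).2 trivial
          exact ⟨m, hm, hm', by rwa [snoc_vert h hm']⟩
      · intro hc m hm hm'
        rw [snoc_vert h hm']
        refine hw.last_noncollider ?_ s hs m hm hm'
        rintro rfl
        obtain ⟨⟨i, hi, hi'⟩, -⟩ := hw.last_collider rfl s hs
        exact hc ⟨⟨i, hi, by rwa [snoc_kind h (by omega)]⟩, ht, by rwa [snoc_kind_last]⟩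
  · intro hκ s hs
    obtain rfl := eq_of_isSection_snoc h hk hs
    subst hκ
    exact ⟨⟨w.length, rfl, by rwa [snoc_kind_last]⟩, fun hM' => ⟨w.length + 1, le_rfl, le_rfl,
      by rw [snoc_vert_last]; exact hM hM'⟩⟩
  · intro hκ s hs i hi
    obtain rfl := eq_of_isSection_snoc h hk hs
    obtain rfl : i = w.length := by omega
    subst hκ
    rwa [snoc_kind_last]
  · intro hκ s hs m hm hm'
    obtain rfl := eq_of_isSection_snoc h hk hs
    rw [snoc_length] at hm'
    obtain rfl : m = w.length + 1 := by omega
    rw [snoc_vert_last]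
    exact hv hκ

end Snoc

/-- A collider section can be prolonged freely along lines. The first invariant records a visit to
`C` at the new end; the second keeps an earlier visit while walking on. -/
theorem Partial.exists_lines {M : Prop} {w : G.Walk} (hw : w.Partial C collider M)
    (h : G.LineConn (w.vert w.length) b) :
    ∃ w' : G.Walk, w'.vert 0 = w.vert 0 ∧ w'.vert w'.length = b ∧
      w'.Partial C collider (M ∨ b ∈ C) ∧ w'.Partial C collider M := by
  induction h with
  | refl =>
    refine ⟨w, rfl, rfl, ⟨hw.before, fun hκ s hs => ?_, hw.last_left, hw.last_noncollider⟩, hw⟩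
    refine ⟨(hw.last_collider hκ s hs).1, ?_⟩
    rintro (hM | hC)
    · exact (hw.last_collider hκ s hs).2 hM
    · exact ⟨w.length, hs.1, le_rfl, hC⟩
  | tail _ h ih =>
    obtain ⟨w', h0, rfl, -, hw'⟩ := ih
    replace h : G.HasEdge .line (w'.vert w'.length) _ := h
    exact ⟨w'.snoc .line _ h, (snoc_vert h (Nat.zero_le _)).trans h0, snoc_vert_last h,
      hw'.snoc_line h rfl (fun h => absurd rfl h) id,
      hw'.snoc_line h rfl (fun h => absurd rfl h) Or.inl⟩

theorem exists_partial (hu : u ∉ C) (h : G.Reach C (u, left) (v, κ)) :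
    ∃ w : G.Walk, w.vert 0 = u ∧ w.vert w.length = v ∧ w.Partial C κ True := by
  suffices H : ∀ s, G.Reach C (u, left) s →
      ∃ w : G.Walk, w.vert 0 = u ∧ w.vert w.length = s.1 ∧ w.Partial C s.2 True from H _ h
  intro s h
  induction h with
  | refl =>
    refine ⟨⟨0, fun _ => u, fun _ => .line, fun m hm => by omega⟩, rfl, rfl, ?_, ?_, ?_, ?_⟩
    · intro s t _ ht
      exact absurd ht (Nat.not_lt_zero _)
    · intro h
      cases h
    · intro _ s hs i hi
      have := hs.1
      simp only at this
      omega
    · exact fun _ _ _ _ _ _ => hu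
  | tail _ h ih =>
    obtain ⟨w, h0, hl, hw⟩ := ih
    cases h with
    | @line _ b κ h ha hb =>
      subst hl
      replace h : G.HasEdge .line (w.vert w.length) b := h
      refine ⟨w.snoc .line b h, (snoc_vert h (Nat.zero_le _)).trans h0, snoc_vert_last h,
        hw.snoc_line h rfl (fun hκ => ?_) Or.inl⟩
      cases κ <;> first | exact hb | exact absurd rfl hκ
    | turn ha =>
      exact ⟨w, h0, hl, ⟨hw.before, nofun, nofun, fun _ => hw.last_noncollider nofun⟩⟩
    | @edge _ b κ κ' k hk h hx he ha hb =>
      subst hl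
      have h0' : (w.snoc k b h).vert 0 = u := (snoc_vert h (Nat.zero_le _)).trans h0
      cases κ' with
      | left => exact ⟨_, h0', snoc_vert_last h, (hw.snoc_edge h hk hx he (fun _ => hb)
          (M := b ∈ C) id).imp_of_ne nofun⟩
      | right => exact ⟨_, h0', snoc_vert_last h, (hw.snoc_edge h hk hx he (fun _ => hb)
          (M := b ∈ C) id).imp_of_ne nofun⟩
      | collider =>
        obtain ⟨c, hc, hbc⟩ := hb
        -- Admissibility only says that the line component of `b` meets `C`, so the new section does
        -- not meet `C` yet, whence `M := False`. The detour along lines from `b` to `c` and back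
        -- repairs this.
        have hw₁ := hw.snoc_edge (M := False) (κ' := collider) h hk hx he (fun h => absurd rfl h)
          False.elim
        obtain ⟨w₂, h₂, h₂', hw₂, -⟩ := hw₁.exists_lines
          (b := c) (by rw [snoc_length, snoc_vert_last]; exact hbc)
        obtain ⟨w₃, h₃, h₃', -, hw₃⟩ := hw₂.exists_lines (b := b) (by rw [h₂']; exact hbc.symm)
        refine ⟨w₃, by rw [h₃, h₂, h0'], h₃', ⟨hw₃.before, fun h s hs => ?_, hw₃.last_left,
          hw₃.last_noncollider⟩⟩
        exact ⟨(hw₃.last_collider h s hs).1, fun _ => (hw₃.last_collider h s hs).2 (.inr hc)⟩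

end Walk

theorem Conn.exists_walk (h : G.Conn C u v) :
    ∃ w : G.Walk, w.vert 0 = u ∧ w.vert w.length = v ∧ w.IsConnecting C := by
  obtain ⟨w, h0, hl, hw⟩ := Walk.exists_partial h.notMem_left h
  refine ⟨w, h0, hl, fun s t hst => ?_⟩
  rcases hst.2.1.lt_or_eq with ht | rfl
  · exact hw.before s t hst ht
  · exact ⟨fun hc => absurd hc.2.1 (lt_irrefl _),
      fun _ => hw.last_noncollider (by simp) s hst⟩

theorem separated_iff {A B : Set V} : G.Separated A B C ↔ ∀ u ∈ A, ∀ v ∈ B, ¬ G.Conn C u v := by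
  constructor
  · intro h u hu v hv huv
    obtain ⟨w, rfl, rfl, hw⟩ := huv.exists_walk
    exact h w hu hv hw
  · exact fun h w h0 hl hw => h _ h0 _ hl hw.conn

theorem markovEquivalent_of_conn_iff {H : MixedGraph V}
    (h : ∀ C u v, u ≠ v → u ∉ C → v ∉ C → (G.Conn C u v ↔ H.Conn C u v)) :
    G.MarkovEquivalent H := by
  intro A B C hAB hAC hBC
  simp only [separated_iff]
  refine forall₂_congr fun u hu => forall₂_congr fun v hv => not_congr (h C u v ?_ ?_ ?_)
  · exact fun huv => Set.disjoint_left.1 hAB hu (huv ▸ hv)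
  · exact Set.disjoint_left.1 hAC hu
  · exact Set.disjoint_left.1 hBC hv

end MixedGraph

namespace MixedGraph

open Relation SectionStatus

variable {V : Type*} {G : MixedGraph V} {C C' : Set V} {u v w x y a b k : V}
  {κ κ' : SectionStatus}

/-! ### Anterior vertices -/

/-- `a` is anterior to `b`: there is a semi-directed walk from `a` to `b`. -/
def Ant (G : MixedGraph V) : V → V → Prop :=
  ReflTransGen fun a b => G.line a b ∨ G.arrow a b

/-- The vertices that are anterior to a vertex of `S`. -/
def anterior (G : MixedGraph V) (S : Set V) : Set V := {a | ∃ b ∈ S, G.Ant a b}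

theorem Ant.refl (a : V) : G.Ant a a := ReflTransGen.refl

theorem Ant.trans (h : G.Ant a b) (h' : G.Ant b v) : G.Ant a v := ReflTransGen.trans h h'

theorem Ant.of_line (h : G.line a b) : G.Ant a b := .single (.inl h)

theorem Ant.of_arrow (h : G.arrow a b) : G.Ant a b := .single (.inr h)

theorem LineConn.ant (h : G.LineConn a b) : G.Ant a b :=
  ReflTransGen.mono (fun _ _ => Or.inl) _ _ h

theorem subset_anterior (S : Set V) : S ⊆ G.anterior S := fun a ha => ⟨a, ha, .refl a⟩

theorem anterior_mono {S T : Set V} (h : S ⊆ T) : G.anterior S ⊆ G.anterior T :=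
  fun _ ⟨b, hb, hab⟩ => ⟨b, h hb, hab⟩

theorem Ant.mem_anterior {S : Set V} (h : G.Ant a b) (hb : b ∈ G.anterior S) :
    a ∈ G.anterior S := by
  obtain ⟨c, hc, hbc⟩ := hb
  exact ⟨c, hc, h.trans hbc⟩

/-- An arrow on the way from `a` to `b` would close to a semi-directed cycle. The classes of mutual
anteriority are thus the line components. -/
theorem IsChain.lineConn (hG : G.IsChain) (h : G.Ant a b) (h' : G.Ant b a) :
    G.LineConn a b := by
  induction h using ReflTransGen.head_induction_on with
  | refl => exact .refl
  | head h₁ h₂ ih =>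
    rcases h₁ with h₁ | h₁
    · exact .head h₁ (ih (h'.trans (.of_line h₁)))
    · exact absurd (Ant.trans h₂ h') (hG _ _ h₁)

/-- The vertices of a connecting walk are anterior to its ends or to the conditioning set. -/
theorem Reach.mem_anterior {s : V × SectionStatus} (h : G.Reach C (u, left) s)
    (hs : s.2 ≠ right) : s.1 ∈ G.anterior (insert u C) := by
  induction h with
  | refl => exact subset_anterior _ (Set.mem_insert _ _)
  | tail _ h ih =>
    cases h with
    | line h ha hb => exact (Ant.of_line (G.line_symm _ _ h)).mem_anterior (ih hs)
    | turn ha => exact absurd rfl hs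
    | @edge _ _ κ κ' k hk h hx he ha hb =>
      cases κ' with
      | left =>
        cases k with
        | line => exact absurd rfl hk
        | forward => exact absurd trivial he
        | arc => exact absurd trivial he
        | backward =>
          refine (Ant.of_arrow h).mem_anterior (ih ?_)
          rintro rfl
          exact hx trivial
      | right => exact absurd rfl hs
      | collider =>
        obtain ⟨c, hc, hbc⟩ := hb
        exact ⟨c, Set.mem_insert_of_mem _ hc, hbc.ant⟩

theorem Reach.mem_anterior_ends {s : V × SectionStatus} (h : G.Reach C (u, left) s)
    (h' : G.Reach C s (w, right)) : s.1 ∈ G.anterior (insert u (insert w C)) := by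
  by_cases hs : s.2 = right
  · have := Reach.mem_anterior (Reach.swap h') (by rw [hs]; simp [SectionStatus.swap])
    exact anterior_mono (Set.subset_insert _ _) this
  · exact anterior_mono (Set.insert_subset_insert (Set.subset_insert _ _)) (h.mem_anterior hs)

theorem _root_.Relation.ReflTransGen.and_of_forall {α : Type*} {r : α → α → Prop} {P : α → Prop}
    {a b : α} (h : ReflTransGen r a b)
    (hP : ∀ x, ReflTransGen r a x → ReflTransGen r x b → P x) :
    ReflTransGen (fun x y => r x y ∧ P x ∧ P y) a b := by
  induction h using ReflTransGen.head_induction_on with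
  | refl => exact .refl
  | head h₁ h₂ ih =>
    exact .head ⟨h₁, hP _ .refl (.head h₁ h₂), hP _ (.single h₁) h₂⟩
      (ih fun x hx hx' => hP x (.head h₁ hx) hx')

theorem Admissible.mono (h : G.Admissible C a κ) (hCC' : C ⊆ C') (ha : a ∈ C' → a ∈ C) :
    G.Admissible C' a κ := by
  cases κ with
  | left => exact fun h' => h (ha h')
  | right => exact fun h' => h (ha h')
  | collider =>
    obtain ⟨c, hc, hac⟩ := h
    exact ⟨c, hCC' hc, hac⟩

/-- Conditioning on vertices that are not anterior to anything relevant has no influence. -/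
theorem Conn.superset (h : G.Conn C u w) (hCC' : C ⊆ C')
    (hC' : ∀ x ∈ C', x ∈ G.anterior (insert u (insert w C)) → x ∈ C) : G.Conn C' u w := by
  refine ReflTransGen.mono (fun s t hst => ?_) _ _ (ReflTransGen.and_of_forall h
    (P := fun s => s.1 ∈ G.anterior (insert u (insert w C))) fun s => Reach.mem_anterior_ends)
  exact hst.1.mono (fun h => h.mono hCC' fun h' => hC' _ h' hst.2.1)
    (fun h => h.mono hCC' fun h' => hC' _ h' hst.2.2)

/-- Follow a semi-directed walk from `a` towards `C`, turn around in a collider section that meets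
`C`, and come back the same way. If only lines precede `C`, the first alternative holds. -/
theorem reach_right_left (ha : a ∈ G.anterior C) :
    (∃ c ∈ C, G.LineConn a c) ∨ a ∉ C ∧ G.Reach C (a, right) (a, left) := by
  obtain ⟨c, hc, hac⟩ := ha
  induction hac using ReflTransGen.head_induction_on with
  | refl => exact .inl ⟨c, hc, .refl⟩
  | @head a b h _ ih =>
    by_cases haC : a ∈ C
    · exact .inl ⟨a, haC, .refl⟩
    rcases h with h | h
    · rcases ih with ⟨c', hc', hbc⟩ | ⟨hb, ih⟩
      · exact .inl ⟨c', hc', (LineConn.of_line h).trans hbc⟩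
      · exact .inr ⟨haC, .head (.line h haC hb) (ih.tail (.line (G.line_symm _ _ h) hb haC))⟩
    · refine .inr ⟨haC, ?_⟩
      rcases ih with hb | ⟨hb, ih⟩
      · exact .head (.edge (κ' := collider) .forward nofun h id trivial haC hb)
          (.single (.edge .backward nofun h trivial id hb haC))
      · exact .head (.edge (κ' := right) .forward nofun h id trivial haC hb)
          (ih.tail (.edge .backward nofun h trivial id hb haC))

/-- The semi-directed walk from `a` to `u`, traversed backwards, has no collider section and avoids
`C`, since a vertex of `C` on it would make `a` anterior to `C`. -/
theorem Ant.reach (h : G.Ant a u) (ha : a ∉ G.anterior C) : G.Reach C (u, left) (a, left) := by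
  induction h using ReflTransGen.head_induction_on with
  | refl => exact .refl
  | @head a b h h' ih =>
    have haC : a ∉ C := fun h => ha (subset_anterior _ h)
    have hb : b ∉ G.anterior C := fun h' => ha (Ant.mem_anterior (.single h) h')
    have hbC : b ∉ C := fun h => hb (subset_anterior _ h)
    refine (ih hb).tail ?_
    rcases h with h | h
    · exact .line (G.line_symm _ _ h) hbC haC
    · exact .edge .backward nofun h trivial id hbC haC

/-- Conditioning on anterior vertices does not create connections. -/
theorem Conn.of_superset (h : G.Conn C' u w) (hCC' : C ⊆ C')
    (hC' : C' ⊆ G.anterior (insert u (insert w C))) : G.Conn C u w := by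
  have hu : u ∉ C := fun hu => h.notMem_left (hCC' hu)
  have hw : w ∉ C := fun hw => h.notMem_right (hCC' hw)
  -- A collider section that needed `C'` to be opened is simulated by status `left`, which allows
  -- every exit. The last disjunct describes this simulation.
  suffices H : ∀ s, G.Reach C' (u, left) s → G.Conn C u w ∨
      ∃ κ, G.Reach C (u, left) (s.1, κ) ∧ G.Admissible C s.1 κ ∧
        (κ = s.2 ∨ s.2 = collider ∧ κ = left ∧ ¬ ∃ c ∈ C, G.LineConn s.1 c) by
    rcases H _ h with h | ⟨κ, h, -, h' | h'⟩
    · exact h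
    · simp only at h'
      subst h'
      exact h
    · cases h'.1
  intro s hs
  induction hs with
  | refl => exact .inr ⟨left, .refl, hu, .inl rfl⟩
  | tail _ hst ih =>
    rcases ih with ih | ⟨κ₀, ih, hκ₀, hκ⟩
    · exact .inl ih
    cases hst with
    | @line a b κ h ha hb =>
      right
      rcases hκ with rfl | ⟨rfl, rfl, hκ⟩
      · have hb' : G.Admissible C b κ₀ := by
          cases κ₀ with
          | left => exact fun h => hb (hCC' h)
          | right => exact fun h => hb (hCC' h)
          | collider =>
            obtain ⟨c, hc, hac⟩ := hκ₀
            exact ⟨c, hc, (LineConn.of_line (G.line_symm _ _ h)).trans hac⟩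
        exact ⟨κ₀, ih.tail (.line h hκ₀ hb'), hb', .inl rfl⟩
      · have hbc : ¬ ∃ c ∈ C, G.LineConn b c := fun ⟨c, hc, hbc⟩ =>
          hκ ⟨c, hc, (LineConn.of_line h).trans hbc⟩
        have hb' : b ∉ C := fun hb => hbc ⟨b, hb, .refl⟩
        exact ⟨left, ih.tail (.line h hκ₀ hb'), hb', .inr ⟨rfl, rfl, hbc⟩⟩
    | turn ha =>
      have ha' := fun h => ha (hCC' h)
      rcases hκ with rfl | ⟨h, -⟩
      · exact .inr ⟨right, ih.tail (.turn ha'), ha', .inl rfl⟩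
      · cases h
    | @edge a b κ κ' k hk h hx he ha hb =>
      have hx' : κ₀.AllowsExit k := by
        rcases hκ with rfl | ⟨-, rfl, -⟩
        · exact hx
        · trivial
      by_cases hb' : G.Admissible C b κ'
      · exact .inr ⟨κ', ih.tail (.edge k hk h hx' he hκ₀ hb'), hb', .inl rfl⟩
      cases κ' with
      | left => exact absurd (fun h => hb (hCC' h)) hb'
      | right => exact absurd (fun h => hb (hCC' h)) hb'
      | collider =>
        have hbC : b ∉ C := fun hbC => hb' ⟨b, hbC, .refl⟩
        have hright : G.Reach C (u, left) (b, right) :=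
          ih.tail (.edge k hk h hx' trivial hκ₀ hbC)
        by_cases hbA : b ∈ G.anterior C
        · rcases reach_right_left hbA with hb'' | ⟨-, hb''⟩
          · exact absurd hb'' hb'
          · exact .inr ⟨left, hright.trans hb'', hbC, .inr ⟨rfl, rfl, hb'⟩⟩
        -- Now `b` is anterior to `u` or `w`: either restart from `u` and reach `b` backwards along
        -- arrows and lines, or go straight to `w`.
        obtain ⟨c, hc, hbc⟩ := hb
        obtain ⟨d, hd, hbd⟩ := hbc.ant.mem_anterior (hC' hc)
        rcases hd with rfl | rfl | hd
        · exact .inr ⟨left, hbd.reach hbA, hbC, .inr ⟨rfl, rfl, hb'⟩⟩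
        · exact .inl (hright.trans (Reach.swap (hbd.reach hbA)))
        · exact absurd ⟨d, hd, hbd⟩ hbA

/-! ### Inseparable vertices -/

/-- The graph in which two vertices are adjacent if they are not separated by any set. -/
def insepGraph (G : MixedGraph V) : SimpleGraph V where
  Adj u v := u ≠ v ∧ ∀ D : Set V, u ∉ D → v ∉ D → G.Conn D u v
  symm := ⟨fun _ _ h => ⟨h.1.symm, fun D hu hv => (h.2 D hv hu).symm⟩⟩
  loopless := ⟨fun _ h => h.1 rfl⟩

theorem HasEdge.insepGraph_adj {k : EdgeKind} (h : G.HasEdge k u v) (huv : u ≠ v) :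
    G.insepGraph.Adj u v :=
  ⟨huv, fun _ hu hv => .of_edge h hu hv⟩

/-- Two separable vertices are separated by the set of their anterior vertices. -/
theorem not_conn_anterior (huw : u ≠ w) (h : ¬ G.insepGraph.Adj u w) :
    ¬ G.Conn (G.anterior {u, w} \ {u, w}) u w := by
  intro hc
  refine h ⟨huw, fun D hu hw => ?_⟩
  have hS : insert u (insert w (G.anterior {u, w} \ {u, w})) = G.anterior {u, w} := by
    have := Set.union_sdiff_cancel (subset_anterior (G := G) {u, w})
    rw [← this]
    ext z
    simp only [Set.mem_insert_iff, Set.mem_union, Set.mem_sdiff, Set.mem_singleton_iff]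
    tauto
  have hAA : G.anterior (G.anterior {u, w}) ⊆ G.anterior {u, w} :=
    fun a ⟨b, hb, hab⟩ => hab.mem_anterior hb
  -- Enlarge the conditioning set to the anterior vertices of `u`, `w` and `D`, which adds nothing
  -- anterior to the pair, and then shrink it to `D`.
  have h₁ := hc.superset (C' := G.anterior (insert u (insert w D)) \ {u, w})
    (Set.sdiff_subset_sdiff_left (anterior_mono (by
      rintro z (rfl | rfl) <;> simp)))
    (by
      rw [hS]
      exact fun x hx hx' => ⟨hAA hx', hx.2⟩)
  refine h₁.of_superset (fun z hz => ⟨subset_anterior _ (by simp [hz]), ?_⟩) Set.sdiff_subset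
  rintro (rfl | rfl)
  · exact hu hz
  · exact hw hz

/-- Consider the first entry of the path into the line component of `v`. Lines cannot enter from
outside. An entry without arrowhead would use an arrow out of the component, to a vertex anterior to
`x` or to a member of `F` outside the component; both are excluded. So the entry has an arrowhead,
and `v ∈ F` opens the collider section. -/
theorem Reach.exists_entry {F : Set V} (hv : v ∈ F) (hF : ∀ d ∈ F, G.Ant v d → G.Ant d v)
    (hG : G.IsChain) (hx : ¬ G.Ant v x) {s : V × SectionStatus}
    (h : G.Reach (F \ {d | G.Ant v d ∧ G.Ant d v}) (x, left) s) :
    (∃ p, G.Ant v p ∧ G.Ant p v ∧ G.Reach F (x, left) (p, collider)) ∨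
      ¬ (G.Ant v s.1 ∧ G.Ant s.1 v) ∧ G.Reach F (x, left) s := by
  induction h with
  | refl => exact .inr ⟨fun h => hx h.1, .refl⟩
  | @tail s t hs hst ih =>
    rcases ih with ih | ⟨hs', ih⟩
    · exact .inl ih
    have key : ∀ z κ, ¬ (G.Ant v z ∧ G.Ant z v) →
        G.Admissible (F \ {d | G.Ant v d ∧ G.Ant d v}) z κ → G.Admissible F z κ :=
      fun z κ hz h => h.mono Set.sdiff_subset fun h' => ⟨h', hz⟩
    by_cases ht : G.Ant v t.1 ∧ G.Ant t.1 v
    · cases hst with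
      | line h ha hb =>
        exact absurd ⟨ht.1.trans (.of_line (G.line_symm _ _ h)), (Ant.of_line h).trans ht.2⟩ hs'
      | turn ha => exact absurd ht hs'
      | @edge a b κ κ' k hk h hx' he ha hb =>
        by_cases hkh : k.HeadAtEnd
        · refine .inl ⟨b, ht.1, ht.2, ih.tail (.edge k hk h hx' hkh (key _ _ hs' ha) ?_)⟩
          exact ⟨v, hv, hG.lineConn ht.2 ht.1⟩
        · exfalso
          cases k with
          | line => exact hk rfl
          | forward => exact hkh trivial
          | arc => exact hkh trivial
          | backward =>
            obtain ⟨d, hd, had⟩ := Reach.mem_anterior hs (by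
              rintro rfl
              exact hx' trivial)
            have hvd : G.Ant v d := (ht.1.trans (.of_arrow h)).trans had
            rcases hd with rfl | hd
            · exact hx hvd
            · exact hd.2 ⟨hvd, hF d hd.1 hvd⟩
    · exact .inr ⟨ht, ih.tail (hst.mono (key _ _ hs') (key _ _ ht))⟩

/-- If neither `x` nor `y` is preceded by the line component of `v`, but both are inseparable from
members of it, then they are connected given any set that contains `v`. -/
theorem conn_of_adj_component (hG : G.IsChain) {v₁ v₂ : V} {E : Set V} (hvE : v ∈ E) (hxE : x ∉ E)
    (hyE : y ∉ E) (hx : ¬ G.Ant v x) (hy : ¬ G.Ant v y) (h₁ : G.LineConn v v₁)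
    (h₂ : G.LineConn v v₂) (hx₁ : G.insepGraph.Adj x v₁) (hy₂ : G.insepGraph.Adj y v₂) :
    G.Conn E x y := by
  set A := G.anterior (insert x (insert y E)) with hA
  -- Everything strictly above the component of `v` is left out, so that paths from `x` and from `y`
  -- must enter the component with an arrowhead.
  set F := {e ∈ A \ {x, y} | G.Ant v e → G.Ant e v} with hFdef
  have hAA : ∀ {a b}, G.Ant a b → b ∈ A → a ∈ A := fun h hb => h.mem_anterior hb
  have hsub : E ⊆ A \ {x, y} := fun z hz => ⟨subset_anterior _ (by simp [hz]), by
    rintro (rfl | rfl)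
    · exact hxE hz
    · exact hyE hz⟩
  have hvF : v ∈ F := ⟨hsub hvE, fun _ => .refl v⟩
  have hFF : ∀ d ∈ F, G.Ant v d → G.Ant d v := fun d hd => hd.2
  have entry : ∀ z v', ¬ G.Ant v z → z ∉ F → G.LineConn v v' → G.insepGraph.Adj z v' →
      ∃ p, G.Ant v p ∧ G.Ant p v ∧ G.Reach F (z, left) (p, collider) := by
    intro z v' hz hzF hvv' hzv'
    have hr := hzv'.2 (F \ {d | G.Ant v d ∧ G.Ant d v}) (fun h => hzF h.1)
      (fun h => h.2 ⟨hvv'.ant, hvv'.symm.ant⟩)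
    rcases Reach.exists_entry hvF hFF hG hz hr with h | h
    · exact h
    · exact absurd ⟨hvv'.ant, hvv'.symm.ant⟩ h.1
  obtain ⟨p, hvp, hpv, hp⟩ := entry x v₁ hx (fun h => h.1.2 (by simp)) h₁ hx₁
  obtain ⟨q, hvq, hqv, hq⟩ := entry y v₂ hy (fun h => h.1.2 (by simp)) h₂ hy₂
  have hc : G.Conn F x y := hp.trans ((Reach.collider_lines
    ((hG.lineConn hpv hvp).trans (hG.lineConn hvq hqv)) ⟨v, hvF, hG.lineConn hpv hvp⟩).trans
    (Reach.swap hq))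
  -- The vertices of `A \ {x, y}` missing from `F` are not anterior to `x`, `y` or `F`, so
  -- conditioning on them is harmless.
  have hc' : G.Conn (A \ {x, y}) x y := by
    refine hc.superset (fun z hz => hz.1) ?_
    rintro z hz ⟨d, hd, hzd⟩
    refine ⟨hz, fun hvz => ?_⟩
    rcases hd with rfl | rfl | hd
    · exact absurd (hvz.trans hzd) hx
    · exact absurd (hvz.trans hzd) hy
    · exact hzd.trans (hd.2 (hvz.trans hzd))
  exact hc'.of_superset hsub Set.sdiff_subset

/-- Follow the path up to the component of `k` under lines outside `C`. Arriving without an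
arrowhead, it extends along lines to `k`; arriving with one, it opens a collider section once `k` is
added to `C`; and while it stays off the component in its non-collider states, it remains valid
after adding `k`. -/
theorem Reach.exists_entry_singleton (hk : k ∉ C) {s : V × SectionStatus}
    (h : G.Reach C (u, left) s) :
    G.Reach C (u, left) (k, left) ∨
      (∃ p, G.LineConn p k ∧ G.Reach (insert k C) (u, left) (p, collider)) ∨
      G.Reach (insert k C) (u, left) s ∧
        (s.2 ≠ collider → ¬ ReflTransGen (fun a b => G.line a b ∧ a ∉ C ∧ b ∉ C) s.1 k) := by
  have hB : ∀ b, ReflTransGen (fun a b => G.line a b ∧ a ∉ C ∧ b ∉ C) b k →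
      G.Reach C (b, left) (k, left) :=
    fun b h => by
      induction h using ReflTransGen.head_induction_on with
      | refl => exact .refl
      | head h _ ih => exact .head (.line h.1 h.2.1 h.2.2) ih
  induction h with
  | refl =>
    by_cases h : ReflTransGen (fun a b => G.line a b ∧ a ∉ C ∧ b ∉ C) u k
    · exact .inl (hB u h)
    · exact .inr (.inr ⟨.refl, fun _ => h⟩)
  | @tail s t hs hst ih =>
    rcases ih with ih | ih | ⟨ih, hsB⟩
    · exact .inl ih
    · exact .inr (.inl ih)
    have key : ∀ z κ, (κ ≠ collider →
        ¬ ReflTransGen (fun a b => G.line a b ∧ a ∉ C ∧ b ∉ C) z k) →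
        G.Admissible C z κ → G.Admissible (insert k C) z κ := by
      intro z κ hz h
      cases κ with
      | left => exact fun h' => h'.elim (fun h' => hz nofun (h' ▸ .refl)) h
      | right => exact fun h' => h'.elim (fun h' => hz nofun (h' ▸ .refl)) h
      | collider =>
        obtain ⟨c, hc, hac⟩ := h
        exact ⟨c, Set.mem_insert_of_mem _ hc, hac⟩
    by_cases ht : t.2 ≠ collider ∧ ReflTransGen (fun a b => G.line a b ∧ a ∉ C ∧ b ∉ C) t.1 k
    · have htC : t.1 ∉ C := by
        rcases ReflTransGen.cases_head ht.2 with h | ⟨_, h, -⟩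
        · exact h ▸ hk
        · exact h.2.1
      cases hst with
      | line h ha hb =>
        refine absurd (.head ⟨h, ?_, htC⟩ ht.2) (hsB ht.1)
        rename_i κ
        cases κ <;> first | exact ha | exact absurd rfl ht.1
      | turn ha => exact absurd ht.2 (hsB nofun)
      | @edge a b κ κ' k' hk' h hx he ha hb =>
        by_cases hkh : k'.HeadAtEnd
        · refine .inr (.inl ⟨b, ?_, ih.tail (.edge k' hk' h hx hkh (key _ _ hsB ha) ?_)⟩)
          · exact ReflTransGen.mono (fun _ _ h => h.1) _ _ ht.2
          · exact ⟨k, Set.mem_insert _ _, ReflTransGen.mono (fun _ _ h => h.1) _ _ ht.2⟩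
        · exact .inl ((hs.tail (.edge (κ' := left) k' hk' h hx hkh ha htC)).trans (hB b ht.2))
    · have ht' : t.2 ≠ collider →
          ¬ ReflTransGen (fun a b => G.line a b ∧ a ∉ C ∧ b ∉ C) t.1 k := fun h h' => ht ⟨h, h'⟩
      exact .inr (.inr ⟨ih.tail (hst.mono (key _ _ hsB) (key _ _ ht')), ht'⟩)

/-- Singleton transitivity of the independence model of a graph. -/
theorem Conn.singleton_transitivity (h : G.Conn C u k) (h' : G.Conn C k w) :
    G.Conn C u w ∨ G.Conn (insert k C) u w := by
  have hk := h.notMem_right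
  rcases Reach.exists_entry_singleton hk h with h₁ | ⟨p, hp, h₁⟩ | ⟨-, h₁⟩
  · exact .inl (ReflTransGen.trans h₁ h')
  · rcases Reach.exists_entry_singleton hk h'.symm with h₂ | ⟨q, hq, h₂⟩ | ⟨-, h₂⟩
    · exact .inl (ReflTransGen.trans h (Reach.swap h₂))
    · exact .inr (h₁.trans ((Reach.collider_lines (hp.trans hq.symm)
        ⟨k, Set.mem_insert _ _, hp⟩).trans (Reach.swap h₂)))
    · exact absurd .refl (h₂ nofun)
  · exact absurd .refl (h₁ nofun)

end MixedGraph

namespace MixedGraph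

open Relation SectionStatus

variable {V : Type*} {G : MixedGraph V} {C C' : Set V} {u v w x y a b k : V}
  {κ κ' : SectionStatus}

theorem Step.eq_or_adj {s t : V × SectionStatus} (h : G.Step C s t) :
    s.1 = t.1 ∨ G.insepGraph.Adj s.1 t.1 := by
  by_cases hst : s.1 = t.1
  · exact .inl hst
  cases h with
  | line h => exact .inr (HasEdge.insepGraph_adj (k := .line) h hst)
  | turn => exact .inl rfl
  | edge k _ h => exact .inr (HasEdge.insepGraph_adj h hst)

theorem Conn.reachable_insepGraph (h : G.Conn C u w) : G.insepGraph.Reachable u w := by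
  suffices H : ∀ s, G.Reach C (u, left) s → G.insepGraph.Reachable u s.1 from H _ h
  intro s h
  induction h with
  | refl => exact .refl _
  | tail _ h ih =>
    rcases h.eq_or_adj with h | h
    · exact h ▸ ih
    · exact ih.trans h.reachable

/-! ### Undirected graphs -/

/-- The graph `H` without the edges that meet `C`. -/
def avoiding (H : SimpleGraph V) (C : Set V) : SimpleGraph V where
  Adj a b := H.Adj a b ∧ a ∉ C ∧ b ∉ C
  symm := ⟨fun _ _ h => ⟨h.1.symm, h.2.2, h.2.1⟩⟩
  loopless := ⟨fun _ h => h.1.ne rfl⟩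

theorem conn_undirected_iff {H : SimpleGraph V} (huw : u ≠ w) :
    (undirected H).Conn C u w ↔ (avoiding H C).Reachable u w := by
  constructor
  · intro h
    suffices ∀ s, (undirected H).Reach C (u, left) s →
      s.2 ≠ collider ∧ (avoiding H C).Reachable u s.1 from (this _ h).2
    intro s h
    induction h with
    | refl => exact ⟨nofun, .refl _⟩
    | tail _ h ih =>
      cases h with
      | @line a b κ h ha hb =>
        have hadj : (avoiding H C).Adj a b := by
          cases κ with
          | left => exact ⟨h, ha, hb⟩
          | right => exact ⟨h, ha, hb⟩
          | collider => exact absurd rfl ih.1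
        exact ⟨ih.1, ih.2.trans hadj.reachable⟩
      | turn ha => exact ⟨nofun, ih.2⟩
      | edge k hk h => cases k <;> first | exact absurd rfl hk | exact h.elim
  · rintro ⟨p⟩
    have hw : ∀ {a b}, (avoiding H C).Walk a b → a ∉ C →
        b ∉ C ∧ (undirected H).Reach C (a, left) (b, left) := by
      intro a b p
      induction p with
      | nil => exact fun h => ⟨h, .refl⟩
      | cons h _ ih =>
        exact fun ha => ⟨(ih h.2.2).1, .head (.line h.1 ha h.2.2) (ih h.2.2).2⟩
    have huC : u ∉ C := by
      cases p with
      | nil => exact absurd rfl huw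
      | cons h _ => exact h.2.1
    exact (hw p huC).2.tail (.turn (hw p huC).1)

/-- The invariant remembers the last vertex `z` outside `C` in a non-collider state. Consecutive
such vertices are equal or inseparable, even across a stretch of collider sections. -/
theorem Conn.reachable_avoiding (hN : ∀ u w, u ≠ w → ¬ G.insepGraph.Adj u w → ¬ G.Conn {u, w}ᶜ u w)
    (h : G.Conn C u w) : (avoiding G.insepGraph C).Reachable u w := by
  suffices H : ∀ s, G.Reach C (u, left) s → ∃ z, z ∉ C ∧
      (avoiding G.insepGraph C).Reachable u z ∧ ((s.2 ≠ collider ∧ s.1 = z) ∨ s.2 = collider ∧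
        ReflTransGen (fun s t => G.Step C s t ∧ t.2 = collider) (z, left) s) by
    obtain ⟨z, -, hz, ⟨-, rfl⟩ | h⟩ := H _ h
    · exact hz
    · cases h.1
  have adj : ∀ {a b}, a ∉ C → b ∉ C → a = b ∨ G.insepGraph.Adj a b →
      (avoiding G.insepGraph C).Reachable u a → (avoiding G.insepGraph C).Reachable u b := by
    rintro a b ha hb (rfl | hab) h
    · exact h
    · exact h.trans (SimpleGraph.Adj.reachable ⟨hab, ha, hb⟩)
  have noncoll : ∀ {a : V} {κ : SectionStatus}, κ ≠ collider → G.Admissible C a κ → a ∉ C := by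
    intro a κ hκ h
    cases κ <;> first | exact h | exact absurd rfl hκ
  intro s hs
  induction hs with
  | refl => exact ⟨u, h.notMem_left, .refl _, .inl ⟨nofun, rfl⟩⟩
  | tail _ hst ih =>
    obtain ⟨z, hzC, hz, ⟨hs, rfl⟩ | ⟨hs, hmid⟩⟩ := ih
    · have hst' := hst.eq_or_adj
      cases hst with
      | line h ha hb =>
        exact ⟨_, noncoll hs hb, adj hzC (noncoll hs hb) hst' hz, .inl ⟨hs, rfl⟩⟩
      | turn ha => exact ⟨_, hzC, hz, .inl ⟨nofun, rfl⟩⟩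
      | @edge a b κ κ' k hk h hx he ha hb =>
        by_cases hκ' : κ' = collider
        · exact ⟨a, hzC, hz, .inr ⟨hκ', .single ⟨.edge k hk h trivial he hzC hb, hκ'⟩⟩⟩
        · exact ⟨b, noncoll hκ' hb, adj hzC (noncoll hκ' hb) hst' hz, .inl ⟨hκ', rfl⟩⟩
    · cases hst with
      | line h ha hb => exact ⟨z, hzC, hz, .inr ⟨hs, hmid.tail ⟨.line h ha hb, hs⟩⟩⟩
      | turn ha => cases hs
      | @edge a b κ κ' k hk h hx he ha hb =>
        by_cases hκ' : κ' = collider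
        · exact ⟨z, hzC, hz, .inr ⟨hκ', hmid.tail ⟨.edge k hk h hx he ha hb, hκ'⟩⟩⟩
        have hbC := noncoll hκ' hb
        refine ⟨b, hbC, adj hzC hbC ?_ hz, .inl ⟨hκ', rfl⟩⟩
        -- The stretch from `z` to `b` stays connecting when all vertices but `z` and `b` are
        -- conditioned on, as its inner sections are colliders opened by vertices of `C`. By `hN`,
        -- such a pair is not separable.
        by_contra! hcon
        refine hN z b hcon.1 hcon.2 ?_
        have hcoll : ∀ {a}, G.Admissible C a collider → G.Admissible {z, b}ᶜ a collider := by
          rintro a ⟨c, hc, hac⟩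
          refine ⟨c, ?_, hac⟩
          rintro (rfl | rfl)
          · exact hzC hc
          · exact hbC hc
        have hreach : ∀ s, ReflTransGen (fun s t => G.Step C s t ∧ t.2 = collider) (z, left) s →
            G.Reach {z, b}ᶜ (z, left) s ∧ (s = (z, left) ∨ s.2 = collider) := by
          intro s h
          induction h with
          | refl => exact ⟨.refl, .inl rfl⟩
          | @tail s t _ h ih =>
            refine ⟨ih.1.tail (h.1.mono (fun h' => ?_) fun h' => ?_), .inr h.2⟩
            · rcases ih.2 with rfl | h''
              · simp [Admissible]
              · rw [h''] at h' ⊢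
                exact hcoll h'
            · rw [h.2] at h' ⊢
              exact hcoll h'
        simp only at hs
        subst hs
        exact (hreach _ hmid).1.tail (.edge k hk h hx trivial (hcoll ha) (by simp [Admissible]))

theorem exists_switch {P : ℕ → Prop} {m n : ℕ} (hmn : m ≤ n) (hm : ¬ P m) (hn : P n) :
    ∃ i, m ≤ i ∧ i < n ∧ ¬ P i ∧ P (i + 1) := by
  induction n, hmn using Nat.le_induction with
  | base => exact absurd hn hm
  | succ n hmn ih =>
    by_cases h : P n
    · obtain ⟨i, hi, hin, h⟩ := ih h
      exact ⟨i, hi, by omega, h⟩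
    · exact ⟨n, hmn, by omega, h, hn⟩

/-- Strong induction on the length. An inner vertex anterior to the ends or to `C` splits the walk,
and singleton transitivity joins the pieces. If there is none, the walk can be shortcut around a
maximal line component. -/
theorem conn_of_walk (hG : G.IsChain)
    (hN : ∀ u w, u ≠ w → ¬ G.insepGraph.Adj u w → ¬ G.Conn {u, w}ᶜ u w) {n : ℕ} :
    ∀ {u w : V} (p : (avoiding G.insepGraph C).Walk u w), p.length = n → u ≠ w →
      G.Conn C u w := by
  induction n using Nat.strong_induction_on with
  | _ n ih =>
  intro u w p hp huw
  have hadj : ∀ i, i < n → (avoiding G.insepGraph C).Adj (p.getVert i) (p.getVert (i + 1)) :=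
    fun i hi => p.adj_getVert_succ (by omega)
  have h0 : p.getVert 0 = u := p.getVert_zero
  have hlast : p.getVert n = w := by rw [← hp]; exact p.getVert_length
  have hn : 0 < n := by
    rcases Nat.eq_zero_or_pos n with rfl | hn
    · exact absurd (h0.symm.trans hlast) huw
    · exact hn
  by_cases hA : ∃ i, 0 < i ∧ i < n ∧ p.getVert i ∈ G.anterior (insert u (insert w C))
  · obtain ⟨i, hi, hin, hiA⟩ := hA
    by_cases hiu : u = p.getVert i
    · exact ih (n - i) (by omega) ((p.drop i).copy hiu.symm rfl) (by simp [hp]) huw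
    by_cases hiw : p.getVert i = w
    · exact ih i (by omega) ((p.take i).copy rfl hiw) (by simp [hp, hin.le]) huw
    have h₁ := ih i hin (p.take i) (by simp [hp, hin.le]) hiu
    have h₂ := ih (n - i) (by omega) (p.drop i) (by simp [hp]) hiw
    rcases h₁.singleton_transitivity h₂ with h | h
    · exact h
    · refine h.of_superset (Set.subset_insert _ _) (Set.insert_subset hiA ?_)
      exact fun z hz => subset_anterior _ (by simp [hz])
  push Not at hA
  by_cases hn2 : n = 1
  · have := hadj 0 hn
    rw [h0, zero_add, ← hn2, hlast] at this
    exact this.1.2 C this.2.1 this.2.2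
  let : Preorder V := { le := G.Ant, le_refl := Ant.refl, le_trans := fun _ _ _ => Ant.trans }
  -- Maximal in the anteriority preorder among the inner vertices; the ends lie outside its
  -- component because `hA` excludes being anterior to them.
  obtain ⟨m, hm, hmax⟩ := Finset.exists_maximalFor p.getVert (Finset.Ioo 0 n)
    ⟨1, Finset.mem_Ioo.2 (by omega)⟩
  rw [Finset.mem_Ioo] at hm
  have hmax : ∀ i, 0 < i → i < n → G.Ant (p.getVert m) (p.getVert i) →
      G.Ant (p.getVert i) (p.getVert m) :=
    fun i hi hi' h => hmax (Finset.mem_Ioo.2 ⟨hi, hi'⟩) h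
  have hmA := hA m hm.1 hm.2
  let K : ℕ → Prop := fun i => G.Ant (p.getVert m) (p.getVert i) ∧ G.Ant (p.getVert i) (p.getVert m)
  have hKm : K m := ⟨.refl _, .refl _⟩
  have hK0 : ¬ G.Ant (p.getVert m) (p.getVert 0) := fun h =>
    hmA ⟨u, by simp, by rwa [h0] at h⟩
  have hKn : ¬ G.Ant (p.getVert m) (p.getVert n) := fun h =>
    hmA ⟨w, by simp, by rwa [hlast] at h⟩
  have hKant : ∀ i, i ≤ n → ¬ K i → ¬ G.Ant (p.getVert m) (p.getVert i) := by
    intro i hi hKi h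
    rcases Nat.eq_zero_or_pos i with rfl | hi0
    · exact hK0 h
    rcases hi.lt_or_eq with hi | rfl
    · exact hKi ⟨h, hmax i hi0 hi h⟩
    · exact hKn h
  obtain ⟨i, -, him, hi, hi'⟩ := exists_switch (P := K) (Nat.zero_le m) (fun h => hK0 h.1) hKm
  obtain ⟨j, hmj, hjn, hj, hj'⟩ := exists_switch (P := fun j => ¬ K j) hm.2.le
    (not_not_intro hKm) (fun h => hKn h.1)
  rw [not_not] at hj
  have hx := hKant i (by omega) hi
  have hy := hKant (j + 1) (by omega) hj'
  -- The vertices just before and just after the stretch around `m` are connected given all others,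
  -- hence equal or inseparable by `hN`. As `i < m ≤ j`, the shortcut is strictly shorter.
  have hxy : p.getVert i = p.getVert (j + 1) ∨
      G.insepGraph.Adj (p.getVert i) (p.getVert (j + 1)) := by
    by_contra! hcon
    refine hN _ _ hcon.1 hcon.2 (conn_of_adj_component hG (v := p.getVert m) ?_ (by simp) (by simp)
      hx hy (hG.lineConn hi'.1 hi'.2) (hG.lineConn hj.1 hj.2) (hadj i (by omega)).1
      (hadj j hjn).1.symm)
    rintro (h | h)
    · exact hx (h ▸ .refl _)
    · exact hy (h ▸ .refl _)
  rcases hxy with hxy | hxy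
  · refine ih _ ?_ (((p.take i).copy rfl hxy).append (p.drop (j + 1))) rfl huw
    simp [hp]
    omega
  · have hxy' : (avoiding G.insepGraph C).Adj (p.getVert i) (p.getVert (j + 1)) :=
      ⟨hxy, (hadj i (by omega)).2.1, (hadj j hjn).2.2⟩
    refine ih _ ?_ ((p.take i).append (.cons hxy' (p.drop (j + 1)))) rfl huw
    rw [SimpleGraph.Walk.length_append, SimpleGraph.Walk.length_cons,
      SimpleGraph.Walk.take_length, SimpleGraph.Walk.drop_length, hp]
    omega

/-- A chain mixed graph in which separable vertices are separated by all other vertices is Markov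
equivalent to an undirected graph. -/
theorem markovEquivalent_undirected (hG : G.IsChain)
    (hN : ∀ u w, u ≠ w → ¬ G.insepGraph.Adj u w → ¬ G.Conn {u, w}ᶜ u w) :
    G.MarkovEquivalent (undirected G.insepGraph) := by
  refine markovEquivalent_of_conn_iff fun C u v huv _ _ => ?_
  rw [conn_undirected_iff huv]
  exact ⟨fun h => h.reachable_avoiding hN, fun ⟨p⟩ => conn_of_walk hG hN p rfl huv⟩

/-! ### Bidirected graphs -/

/-- A graph all of whose edges are arcs, apart from loops, is Markov equivalent to a bidirected
graph. -/
theorem markovEquivalent_bidirected (hline : ∀ a b, G.line a b → a = b)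
    (harrow : ∀ a b, ¬ G.arrow a b) : G.MarkovEquivalent (bidirected G.insepGraph) := by
  have hconn : ∀ {a b}, G.LineConn a b → a = b := by
    intro a b h
    induction h with
    | refl => rfl
    | tail _ h ih => exact ih.trans (hline _ _ h)
  have hconn' : ∀ {a b}, (bidirected G.insepGraph).LineConn a b → a = b := by
    intro a b h
    induction h with
    | refl => rfl
    | tail _ h ih => exact h.elim
  have hadm : ∀ {C a κ}, G.Admissible C a κ ↔ (bidirected G.insepGraph).Admissible C a κ := by
    intro C a κ
    cases κ with
    | left => rfl
    | right => rfl
    | collider =>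
      constructor
      · rintro ⟨c, hc, hac⟩
        exact ⟨c, hc, hconn hac ▸ .refl⟩
      · rintro ⟨c, hc, hac⟩
        exact ⟨c, hc, hconn' hac ▸ .refl⟩
  have harc : ∀ {a b}, G.insepGraph.Adj a b → G.arc a b := by
    intro a b hab
    -- Given the empty set no collider section is open, and an arc enters with status `right`, which
    -- forbids leaving along another arc. So a connecting path uses just one arc apart from loops.
    suffices H : ∀ s, G.Reach ∅ (a, left) s → s.1 = a ∨ G.arc a s.1 ∧ s.2 = right by
      rcases H _ (hab.2 ∅ (by simp) (by simp)) with h | h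
      · exact absurd h.symm hab.1
      · exact h.1
    intro s h
    induction h with
    | refl => exact .inl rfl
    | tail _ h ih =>
      cases h with
      | line h => exact hline _ _ h ▸ ih
      | turn => exact ih.imp id fun h => ⟨h.1, rfl⟩
      | @edge a' b κ κ' k hk h hx he ha hb =>
        cases k with
        | line => exact absurd rfl hk
        | forward => exact absurd h (harrow _ _)
        | backward => exact absurd h (harrow _ _)
        | arc =>
          have hκ' : κ' = right := by
            cases κ' with
            | left => exact absurd trivial he
            | right => rfl
            | collider => exact absurd hb.choose_spec.1 (Set.notMem_empty _)
          rcases ih with rfl | ⟨-, rfl⟩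
          · exact .inr ⟨h, hκ'⟩
          · exact absurd trivial hx
  refine markovEquivalent_of_conn_iff fun C u v huv _ _ => ⟨fun h => ?_, fun h => ?_⟩
  · suffices H : ∀ s, G.Reach C (u, left) s → (bidirected G.insepGraph).Reach C (u, left) s from
      H _ h
    intro s h
    induction h with
    | refl => exact .refl
    | tail _ h ih =>
      cases h with
      | line h => exact hline _ _ h ▸ ih
      | turn ha => exact ih.tail (.turn ha)
      | @edge a b κ κ' k hk h hx he ha hb =>
        -- An arc loop has no counterpart on the other side. The statuses before and after it are
        -- either both `collider`, or `left` and then `right`, which is a `turn`; in the other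
        -- combinations the arc is not allowed or `a` would be both in and outside `C`.
        by_cases hab : a = b
        · subst hab
          cases k with
          | line => exact absurd rfl hk
          | forward => exact absurd h (harrow _ _)
          | backward => exact absurd h (harrow _ _)
          | arc =>
            have hc : G.Admissible C a collider → a ∈ C := fun ⟨c, hc, hac⟩ => hconn hac ▸ hc
            cases κ <;> cases κ' <;> first
              | exact absurd trivial he
              | exact absurd trivial hx
              | exact absurd (hc ha) hb
              | exact absurd (hc hb) ha
              | exact ih
              | exact ih.tail (.turn ha)
        · have h' := h.insepGraph_adj hab
          cases k with
          | line => exact absurd rfl hk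
          | forward => exact absurd h (harrow _ _)
          | backward => exact absurd h (harrow _ _)
          | arc => exact ih.tail (.edge .arc hk h' hx he (hadm.1 ha) (hadm.1 hb))
  · refine ReflTransGen.mono (fun s t h => ?_) _ _ h
    cases h with
    | line h => exact h.elim
    | turn ha => exact .turn ha
    | edge k hk h hx he ha hb =>
      cases k with
      | line => exact h.elim
      | forward => exact h.elim
      | backward => exact h.elim
      | arc => exact .edge .arc hk (harc h) hx he (hadm.2 ha) (hadm.2 hb)

end MixedGraph

/-! ### Undirected or bidirected: a criterion by homogeneity -/

namespace MixedGraph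

open Relation SectionStatus

variable {V : Type*} {G : MixedGraph V} {C : Set V} {u v w : V}

/-- The components of the inseparability graph have at most two vertices, and a connecting walk
stays in one component. -/
theorem not_conn_of_forall_adj_adj (h : ∀ a b c, G.insepGraph.Adj a b → G.insepGraph.Adj b c → a = c)
    (huw : u ≠ w) (hadj : ¬ G.insepGraph.Adj u w) : ¬ G.Conn C u w := by
  intro hc
  obtain ⟨p⟩ := hc.reachable_insepGraph
  have key : ∀ {a b} (p : G.insepGraph.Walk a b), a = b ∨ G.insepGraph.Adj a b := by
    intro a b p
    induction p with
    | nil => exact .inl rfl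
    | cons hab _ ih =>
      rcases ih with rfl | ih
      · exact .inr hab
      · exact .inl (h _ _ _ hab ih)
  exact (key p).elim huw hadj

/-- A vertex between two separable vertices is anterior to them if it belongs to some set that
separates them. -/
theorem mem_anterior_of_not_conn (hG : G.IsChain) {E : Set V} (huv : G.insepGraph.Adj u v)
    (hvw : G.insepGraph.Adj v w) (hv : v ∈ E) (hu : u ∉ E) (hw : w ∉ E) (h : ¬ G.Conn E u w) :
    G.Ant v u ∨ G.Ant v w := by
  by_contra! hcon
  exact h (conn_of_adj_component hG hv hu hw hcon.1 hcon.2 .refl .refl huv hvw.symm)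

theorem exists_not_conn_of_mem_anterior (huv : u ≠ v) (hvw : v ≠ w) (huw : u ≠ w)
    (h : ¬ G.insepGraph.Adj u w) (hv : G.Ant v u ∨ G.Ant v w) :
    ∃ E, v ∈ E ∧ u ∉ E ∧ w ∉ E ∧ ¬ G.Conn E u w := by
  refine ⟨G.anterior {u, w} \ {u, w}, ⟨?_, ?_⟩, fun h => h.2 (by simp), fun h => h.2 (by simp),
    not_conn_anterior huw h⟩
  · rcases hv with hv | hv
    · exact ⟨u, by simp, hv⟩
    · exact ⟨w, by simp, hv⟩
  · simp [huv.symm, hvw]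

theorem exists_top [Finite V] (G : MixedGraph V) (x : V) :
    ∃ t, G.Ant x t ∧ ∀ y, G.Ant t y → G.Ant y t := by
  let : Preorder V := { le := G.Ant, le_refl := Ant.refl, le_trans := fun _ _ _ => Ant.trans }
  obtain ⟨t, ht, hmax⟩ := Set.Finite.exists_maximalFor id {y | G.Ant x y} (Set.toFinite _)
    ⟨x, .refl x⟩
  exact ⟨t, ht, fun y hy => hmax (Ant.trans ht hy) hy⟩

/-- A set that contains every vertex of which some member is anterior, if the middle vertices of
all unshielded triples are anterior to one of the outer vertices. -/
def IsTripleClosed (H : SimpleGraph V) (K : Set V) : Prop :=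
  ∀ u v w, v ∈ K → H.Adj u v → H.Adj v w → u ≠ w → ¬ H.Adj u w → u ∈ K ∨ w ∈ K

/-- The vertices above a maximal `t` form its line component up to mutual anteriority, and `hH`
makes this class triple closed. If everything is anterior to `t`, any non-neighbour completes the
pair. Otherwise a second maximal class is disjoint from the first, and `hcover` supplies one vertex
from each. -/
theorem exists_anterior_eq_univ [Finite V] [Nonempty V] {H : SimpleGraph V}
    (hH : ∀ u v w, H.Adj u v → H.Adj v w → u ≠ w → ¬ H.Adj u w → G.Ant v u ∨ G.Ant v w)
    (hex : ∀ d, ∃ e, d ≠ e ∧ ¬ H.Adj d e)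
    (hcover : ∀ K K' : Set V, K.Nonempty → K'.Nonempty → Disjoint K K' → IsTripleClosed H K →
      IsTripleClosed H K' → (∀ x, x ∈ K ∨ x ∈ K') ∧ ∃ u ∈ K, ∃ w ∈ K', u ≠ w ∧ ¬ H.Adj u w) :
    ∃ u w, u ≠ w ∧ ¬ H.Adj u w ∧ G.anterior {u, w} = Set.univ := by
  have hclosed : ∀ t, IsTripleClosed H {x | G.Ant t x} := fun t u v w hv huv hvw huw h =>
    (hH u v w huv hvw huw h).imp (Ant.trans hv) (Ant.trans hv)
  obtain ⟨t, -, ht⟩ := G.exists_top (Classical.arbitrary V)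
  by_cases hall : ∀ x, G.Ant x t
  · obtain ⟨e, hte, hadj⟩ := hex t
    exact ⟨t, e, hte, hadj, Set.eq_univ_of_forall fun x => ⟨t, by simp, hall x⟩⟩
  · push Not at hall
    obtain ⟨x, hx⟩ := hall
    obtain ⟨t', hxt', ht'⟩ := G.exists_top x
    have hdisj : Disjoint {x | G.Ant t x} {x | G.Ant t' x} := by
      rw [Set.disjoint_left]
      exact fun z hz hz' => hx (hxt'.trans (Ant.trans hz' (ht z hz)))
    obtain ⟨hcov, u, hu, w, hw, huw, hadj⟩ := hcover _ _ ⟨t, .refl t⟩ ⟨t', .refl t'⟩ hdisj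
      (hclosed t) (hclosed t')
    refine ⟨u, w, huw, hadj, Set.eq_univ_of_forall fun z => ?_⟩
    rcases hcov z with hz | hz
    · exact ⟨u, by simp, (ht z hz).trans hu⟩
    · exact ⟨w, by simp, (ht' z hz).trans hw⟩

/-- A criterion for Markov equivalence to an undirected or a bidirected graph in terms of the
homogeneity of the independence model. -/
theorem markovEquivalent_undirected_or_bidirected [Finite V] (hG : G.IsChain)
    {H : SimpleGraph V} (hH : G.insepGraph = H)
    (hpair : ∀ u w u' w', u ≠ w → ¬ H.Adj u w → u' ≠ w' → ¬ H.Adj u' w' →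
      ¬ G.Conn {u, w}ᶜ u w → ¬ G.Conn {u', w'}ᶜ u' w')
    (htriple : ∀ u v w u' v' w', H.Adj u v → H.Adj v w → u ≠ w → ¬ H.Adj u w →
      H.Adj u' v' → H.Adj v' w' → u' ≠ w' → ¬ H.Adj u' w' →
      (∃ E, v ∈ E ∧ u ∉ E ∧ w ∉ E ∧ ¬ G.Conn E u w) →
      ∃ E, v' ∈ E ∧ u' ∉ E ∧ w' ∉ E ∧ ¬ G.Conn E u' w')
    (hext : ∀ a b, H.Adj a b → ∃ c, H.Adj b c ∧ a ≠ c ∧ ¬ H.Adj a c)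
    (hex : ∀ d, ∃ e, d ≠ e ∧ ¬ H.Adj d e)
    (hcover : ∀ K K' : Set V, K.Nonempty → K'.Nonempty → Disjoint K K' → IsTripleClosed H K →
      IsTripleClosed H K' → (∀ x, x ∈ K ∨ x ∈ K') ∧ ∃ u ∈ K, ∃ w ∈ K', u ≠ w ∧ ¬ H.Adj u w) :
    G.MarkovEquivalent (undirected H) ∨ G.MarkovEquivalent (bidirected H) := by
  subst hH
  by_cases hE : ∃ u v w, G.insepGraph.Adj u v ∧ G.insepGraph.Adj v w ∧ u ≠ w ∧
      ¬ G.insepGraph.Adj u w ∧ ∃ E, v ∈ E ∧ u ∉ E ∧ w ∉ E ∧ ¬ G.Conn E u w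
  · left
    obtain ⟨u, v, w, huv, hvw, huw, hadj, hE⟩ := hE
    have hne : Nonempty V := ⟨u⟩
    have hant : ∀ u v w, G.insepGraph.Adj u v → G.insepGraph.Adj v w → u ≠ w →
        ¬ G.insepGraph.Adj u w → G.Ant v u ∨ G.Ant v w := by
      intro u' v' w' huv' hvw' huw' hadj'
      obtain ⟨E, hv, hu, hw, hE⟩ := htriple u v w u' v' w' huv hvw huw hadj huv' hvw' huw' hadj' hE
      exact mem_anterior_of_not_conn hG huv' hvw' hv hu hw hE
    obtain ⟨x, y, hxy, hadj', hA⟩ := exists_anterior_eq_univ hant hex hcover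
    have := not_conn_anterior hxy hadj'
    rw [hA, ← Set.compl_eq_univ_sdiff] at this
    exact markovEquivalent_undirected hG fun u' w' huw' h' =>
      hpair x y u' w' hxy hadj' huw' h' this
  · right
    -- If `b` were anterior to `a`, then in an unshielded triple a, b, c the anterior separator of
    -- `a` and `c` would contain `b`, against `hE`.
    have hedge : ∀ a b, a ≠ b → G.insepGraph.Adj a b → ¬ (G.Ant b a) := by
      intro a b hne hab hba
      obtain ⟨c, hbc, hac, hadj⟩ := hext a b hab
      exact hE ⟨a, b, c, hab, hbc, hac, hadj,
        exists_not_conn_of_mem_anterior hne hbc.ne hac hadj (.inl hba)⟩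
    refine markovEquivalent_bidirected (fun a b h => ?_) fun a b h => ?_
    · by_contra hne
      exact hedge a b hne (HasEdge.insepGraph_adj (k := .line) h hne)
        (.of_line (G.line_symm _ _ h))
    · by_cases hne : a = b
      · subst hne
        exact hG _ _ h .refl
      · exact hedge b a (Ne.symm hne) (HasEdge.insepGraph_adj (k := .forward) h hne).symm
          (.of_arrow h)

end MixedGraph

/-! ### Exchangeability -/

section Exchangeable

open MeasureTheory ProbabilityTheory

variable {V : Type*}

/-- Invariance on singletons makes `P` its own push-forward under `x ↦ x ∘ σ`; the events for the
images of `A`, `B`, `C` are preimages under this map. -/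
theorem CondIndependent.image [Finite V] {P : Measure (V → Bool)} [IsFiniteMeasure P] (σ : V ≃ V)
    (hP : ∀ x : V → Bool, P {x} = P {x ∘ σ}) {A B C : Set V} (h : CondIndependent P A B C) :
    CondIndependent P (σ '' A) (σ '' B) (σ '' C) := by
  have hmap : P.map (fun x => x ∘ σ) = P := by
    refine Measure.ext_of_singleton fun x => ?_
    rw [Measure.map_apply (measurable_of_finite _) (measurableSet_singleton _),
      show (fun x : V → Bool => x ∘ σ) ⁻¹' {x} = {x ∘ σ.symm} from ?_, hP]
    · congr 2
      ext a
      simp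
    · ext y
      simp only [Set.mem_preimage, Set.mem_singleton_iff]
      exact ⟨fun h => by ext a; simp [← h], fun h => by ext a; simp [h]⟩
  have hpre : ∀ S : Set (V → Bool), P ((fun x => x ∘ σ) ⁻¹' S) = P S := by
    intro S
    conv_rhs => rw [← hmap]
    rw [Measure.map_apply (measurable_of_finite _) (Set.toFinite S).measurableSet]
  have hcond : ∀ S T : Set (V → Bool),
      cond P ((fun x => x ∘ σ) ⁻¹' S) ((fun x => x ∘ σ) ⁻¹' T) = cond P S T := by
    intro S T
    rw [cond_apply (Set.toFinite _).measurableSet, cond_apply (Set.toFinite _).measurableSet,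
      ← Set.preimage_inter, hpre, hpre]
  have hrestrict : ∀ (D : Set V) (d : (σ '' D : Set V) → Bool),
      {x : V → Bool | (σ '' D).domRestrict x = d} = (fun x => x ∘ σ) ⁻¹'
        {x | D.domRestrict x = fun a : D => d ⟨σ a, Set.mem_image_of_mem _ a.2⟩} := by
    intro D d
    ext x
    simp only [Set.mem_ofPred_eq, Set.mem_preimage, funext_iff]
    constructor
    · exact fun h a => h ⟨σ a, Set.mem_image_of_mem _ a.2⟩
    · rintro h ⟨_, a, ha, rfl⟩
      exact h ⟨a, ha⟩
  intro S b c hbc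
  have hS : {x : V → Bool | (σ '' A).domRestrict x ∈ S} = (fun x => x ∘ σ) ⁻¹'
      {x | A.domRestrict x ∈ (fun f (a : A) => f ⟨σ a, Set.mem_image_of_mem _ a.2⟩) '' S} := by
    ext x
    simp only [Set.mem_ofPred_eq, Set.mem_preimage]
    constructor
    · exact fun h => ⟨_, h, rfl⟩
    · rintro ⟨f, hf, hfx⟩
      convert hf
      ext ⟨_, a, ha, rfl⟩
      exact (congrFun hfx ⟨a, ha⟩).symm
  rw [hrestrict B, hrestrict C, ← Set.preimage_inter] at hbc ⊢
  rw [hpre] at hbc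
  rw [hS, hcond, hcond]
  exact h _ _ _ hbc

theorem IsFaithful.not_conn_image [Finite V] {P : Measure (V → Bool)} [IsFiniteMeasure P]
    {G : MixedGraph V} (hPG : IsFaithful P G) (σ : V ≃ V)
    (hP : ∀ x : V → Bool, P {x} = P {x ∘ σ}) {C : Set V} {u w : V} (huw : u ≠ w) (hu : u ∉ C)
    (hw : w ∉ C) (h : ¬ G.Conn C u w) : ¬ G.Conn (σ '' C) (σ u) (σ w) := by
  have h₁ : G.Separated {u} {w} C := by
    rw [MixedGraph.separated_iff]
    rintro _ rfl _ rfl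
    exact h
  have h₂ := ((hPG {u} {w} C (by simpa using huw) (by simpa using hu) (by simpa using hw)).1
    h₁).image σ hP
  simp only [Set.image_singleton] at h₂
  have h₃ := (hPG {σ u} {σ w} (σ '' C) (by simpa using huw) (by simpa using hu)
    (by simpa using hw)).2 h₂
  exact MixedGraph.separated_iff.1 h₃ _ rfl _ rfl

end Exchangeable

/-! ### Dyads -/

theorem Fin.exists_notMem_of_card_lt {n : ℕ} (s : Finset (Fin n)) (h : s.card < n) :
    ∃ x, x ∉ s := by
  by_contra! hs
  have := Finset.card_le_card (fun x _ => hs x : Finset.univ ⊆ s)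
  simp at this
  omega

theorem Fin.exists_ne_three {n : ℕ} (hn : 4 ≤ n) (a b c : Fin n) : ∃ x, x ≠ a ∧ x ≠ b ∧ x ≠ c := by
  obtain ⟨x, hx⟩ := Fin.exists_notMem_of_card_lt {a, b, c} (Finset.card_le_three.trans_lt hn)
  exact ⟨x, by simpa using hx⟩

theorem Fin.exists_ne_four {n : ℕ} (hn : 5 ≤ n) (a b c d : Fin n) :
    ∃ x, x ≠ a ∧ x ≠ b ∧ x ≠ c ∧ x ≠ d := by
  obtain ⟨x, hx⟩ := Fin.exists_notMem_of_card_lt {a, b, c, d} (Finset.card_le_four.trans_lt hn)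
  exact ⟨x, by simpa using hx⟩

/-! ### Combinatorics of closed families of node pairs -/

section Rules

variable {α : Type*} {r s : α → α → Prop}

/-- Suppose no vertex is joined to all others. For joined `a`, `b`, the rule makes any non-neighbour
of `a` equal to any non-neighbour of `b`. Passing from `a` to its neighbours, one vertex `m` is the
only non-neighbour of them all, so everything off `m` is joined. -/
theorem exists_star_or_avoid (hr : ∀ a b, r a b → r b a)
    (hrule : ∀ a b c d, a ≠ b → a ≠ c → a ≠ d → b ≠ c → b ≠ d → c ≠ d → r a b → r a c ∨ r b d)
    {a b : α} (hab : a ≠ b) (h : r a b) :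
    ∃ m, (∀ x, x ≠ m → r m x) ∨ ∀ x y, x ≠ y → x ≠ m → y ≠ m → r x y := by
  by_cases hs : ∃ m, ∀ x, x ≠ m → r m x
  · exact hs.imp fun m h => .inl h
  push Not at hs
  obtain ⟨c, hca, hc⟩ := hs a
  have unique : ∀ a b c d, a ≠ b → r a b → c ≠ a → ¬ r a c → d ≠ b → ¬ r b d → c = d := by
    intro a b c d hab h hca hc hdb hd
    by_contra hcd
    have hbc : b ≠ c := fun e => hc (e ▸ h)
    have had : a ≠ d := fun e => hd (e ▸ hr _ _ h)
    exact (hrule a b c d hab hca.symm had hbc hdb.symm hcd h).elim hc hd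
  have hzc : ∀ z, z ≠ a → r a z → ∀ d, d ≠ z → ¬ r z d → d = c :=
    fun z hz haz d hd hzd => (unique a z c d hz.symm haz hca hc hd hzd).symm
  obtain ⟨d, hdb, hd⟩ := hs b
  have hdc := hzc b hab.symm h d hdb hd
  subst hdc
  have haz : ∀ z, z ≠ a → z ≠ d → r a z := by
    intro z hza hzd
    by_contra hz
    exact hzd (unique a b z d hab h hza hz hdb hd)
  refine ⟨d, .inr fun x y hxy hx hy => ?_⟩
  by_cases hxa : x = a
  · subst hxa
    exact haz y hxy.symm hy
  · by_contra hn
    exact hy (hzc x hxa (haz x hxa hx) y hxy.symm hn)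

/-- Two stars, or two families of all pairs off a vertex, share a pair when there are four nodes.
Disjointness leaves a star at `m` and all pairs off the same `m`, and these cover everything. -/
theorem cover_of_line_rule {n : ℕ} {r s : Fin n → Fin n → Prop} (hn : 4 ≤ n)
    (hr : ∀ a b, r a b → r b a) (hs : ∀ a b, s a b → s b a) (hrs : ∀ a b, r a b → ¬ s a b)
    (hrule : ∀ a b c d, a ≠ b → a ≠ c → a ≠ d → b ≠ c → b ≠ d → c ≠ d → r a b → r a c ∨ r b d)
    (hrule' : ∀ a b c d, a ≠ b → a ≠ c → a ≠ d → b ≠ c → b ≠ d → c ≠ d → s a b → s a c ∨ s b d)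
    {a b a' b' : Fin n} (hab : a ≠ b) (h : r a b) (hab' : a' ≠ b') (h' : s a' b') :
    (∀ x y, x ≠ y → r x y ∨ s x y) ∧
      ∃ i j k l, i ≠ j ∧ i ≠ k ∧ i ≠ l ∧ j ≠ k ∧ j ≠ l ∧ k ≠ l ∧ r i j ∧ s k l := by
  have main : ∀ {r s : Fin n → Fin n → Prop}, (∀ a b, r a b → r b a) →
      ∀ m, (∀ x, x ≠ m → r m x) → (∀ x y, x ≠ y → x ≠ m → y ≠ m → s x y) →
      (∀ x y, x ≠ y → r x y ∨ s x y) ∧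
        ∃ i j k l, i ≠ j ∧ i ≠ k ∧ i ≠ l ∧ j ≠ k ∧ j ≠ l ∧ k ≠ l ∧ r i j ∧ s k l := by
    intro r s hr m h₁ h₂
    constructor
    · intro x y hxy
      by_cases hx : x = m
      · exact .inl (hx ▸ h₁ y (hx ▸ hxy.symm))
      by_cases hy : y = m
      · exact .inl (hr _ _ (hy ▸ h₁ x hx))
      · exact .inr (h₂ x y hxy hx hy)
    · obtain ⟨j, hj, -, -⟩ := Fin.exists_ne_three hn m m m
      obtain ⟨k, hk, hkj, -⟩ := Fin.exists_ne_three hn m j j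
      obtain ⟨l, hl, hlj, hlk⟩ := Fin.exists_ne_three hn m j k
      exact ⟨m, j, k, l, hj.symm, hk.symm, hl.symm, hkj.symm, hlj.symm, hlk.symm, h₁ j hj,
        h₂ k l hlk.symm hk hl⟩
  obtain ⟨m, hm⟩ := exists_star_or_avoid hr hrule hab h
  obtain ⟨m', hm'⟩ := exists_star_or_avoid hs hrule' hab' h'
  obtain ⟨x, hx, hx', -⟩ := Fin.exists_ne_three hn m m' m'
  obtain ⟨y, hy, hy', hyx⟩ := Fin.exists_ne_three hn m m' x
  rcases hm with hm | hm <;> rcases hm' with hm' | hm'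
  · by_cases hmm : m = m'
    · subst hmm
      exact absurd (hm' x hx) (hrs _ _ (hm x hx))
    · exact absurd (hs _ _ (hm' m hmm)) (hrs _ _ (hm m' (Ne.symm hmm)))
  · by_cases hmm : m = m'
    · subst hmm
      exact main hr m hm hm'
    · exact absurd (hm' m x hx.symm hmm hx') (hrs _ _ (hm x hx))
  · by_cases hmm : m = m'
    · subst hmm
      obtain ⟨h₁, i, j, k, l, hij, hik, hil, hjk, hjl, hkl, h₂, h₃⟩ := main hs m hm' hm
      exact ⟨fun x y hxy => (h₁ x y hxy).symm, k, l, i, j, hkl, hik.symm, hjk.symm, hil.symm,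
        hjl.symm, hij, h₃, h₂⟩
    · exact absurd (hm' x hx') (hrs _ _ (hm m' x hx'.symm (Ne.symm hmm) hx))
  · exact absurd (hm' y x hyx hy' hx') (hrs _ _ (hm y x hyx hy hx))

theorem cover_of_kneser_rule_aux {r s : Fin 5 → Fin 5 → Prop} (hr : ∀ a b, r a b → r b a)
    (hs : ∀ a b, s a b → s b a) (hrs : ∀ a b, r a b → ¬ s a b)
    (hrule : ∀ a b c d e, [a, b, c, d, e].Nodup → r a b → r c d ∨ r c e)
    (hrule' : ∀ a b c d e, [a, b, c, d, e].Nodup → s a b → s c d ∨ s c e)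
    (hab : r 0 1) (hac : s 0 2) (hde : r 3 4) :
    (r 1 2 ∨ s 1 2) ∧ (r 0 3 ∨ s 0 3) ∧ (r 1 3 ∨ s 1 3) ∧ (r 2 3 ∨ s 2 3) := by
  have hbd : s 3 1 := (hrule' 0 2 3 1 4 (by decide) hac).resolve_right (hrs _ _ hde)
  have hbe : s 4 1 := (hrule' 0 2 4 1 3 (by decide) hac).resolve_right (hrs _ _ (hr _ _ hde))
  have hbc : r 2 1 :=
    (hrule 3 4 2 0 1 (by decide) hde).resolve_left fun h => hrs _ _ (hr _ _ h) hac
  refine ⟨.inl (hr _ _ hbc), ?_, .inr (hs _ _ hbd), ?_⟩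
  · rcases hrule 0 1 2 3 4 (by decide) hab with h | h
    · exact .inr (hs _ _ ((hrule' 4 1 3 0 2 (by decide) hbe).resolve_right (hrs _ _ (hr _ _ h))))
    · exact .inl (hr _ _ ((hrule 2 4 3 0 1 (by decide) h).resolve_right fun h => hrs _ _ h hbd))
  · rcases hrule 0 1 2 3 4 (by decide) hab with h | h
    · exact .inl h
    · have hae := (hrule' 3 1 4 0 2 (by decide) hbd).resolve_right (hrs _ _ (hr _ _ h))
      exact .inr ((hrule' 4 0 2 1 3 (by decide) hae).resolve_left (hrs _ _ hbc))

/-- If `3 4` is in neither family, repeated use of the rules puts `4 0` and `4 2` in `r` and `3 1`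
in `s`, against the rule for `s`. If `s 3 4`, the two families exchange roles together with the
nodes 1 and 2. -/
theorem cover_of_kneser_rule_five {r s : Fin 5 → Fin 5 → Prop} (hr : ∀ a b, r a b → r b a)
    (hs : ∀ a b, s a b → s b a) (hrs : ∀ a b, r a b → ¬ s a b)
    (hrule : ∀ a b c d e, [a, b, c, d, e].Nodup → r a b → r c d ∨ r c e)
    (hrule' : ∀ a b c d e, [a, b, c, d, e].Nodup → s a b → s c d ∨ s c e)
    (hab : r 0 1) (hac : s 0 2) :
    (r 3 4 ∨ s 3 4) ∧ (r 1 2 ∨ s 1 2) ∧ (r 0 3 ∨ s 0 3) ∧ (r 1 3 ∨ s 1 3) ∧ (r 2 3 ∨ s 2 3) := by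
  by_cases hde : r 3 4
  · exact ⟨.inl hde, cover_of_kneser_rule_aux hr hs hrs hrule hrule' hab hac hde⟩
  by_cases hde' : s 3 4
  · let σ : Equiv.Perm (Fin 5) := Equiv.swap 1 2
    have hnd : ∀ a b c d e : Fin 5, [a, b, c, d, e].Nodup → [σ a, σ b, σ c, σ d, σ e].Nodup :=
      fun a b c d e h => h.map σ.injective
    obtain ⟨h₁, h₂, h₃, h₄⟩ := cover_of_kneser_rule_aux (r := fun a b => s (σ a) (σ b))
      (s := fun a b => r (σ a) (σ b)) (fun _ _ => hs _ _) (fun _ _ => hr _ _)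
      (fun _ _ h h' => hrs _ _ h' h) (fun a b c d e h => hrule' _ _ _ _ _ (hnd a b c d e h))
      (fun a b c d e h => hrule _ _ _ _ _ (hnd a b c d e h)) hac hab hde'
    refine ⟨.inr hde', ?_, h₂.symm, h₄.symm, h₃.symm⟩
    exact h₁.symm.imp (hr 2 1) (hs 2 1)
  · exfalso
    have hcd : r 3 2 := (hrule 0 1 3 2 4 (by decide) hab).resolve_right hde
    have hce : r 4 2 :=
      (hrule 0 1 4 2 3 (by decide) hab).resolve_right fun h => hde (hr _ _ h)
    have hbd : s 3 1 := (hrule' 0 2 3 1 4 (by decide) hac).resolve_right hde'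
    have hbe : s 4 1 :=
      (hrule' 0 2 4 1 3 (by decide) hac).resolve_right fun h => hde' (hs _ _ h)
    have hae : r 4 0 := (hrule 3 2 4 0 1 (by decide) hcd).resolve_right fun h => hrs _ _ h hbe
    exact (hrule' 3 1 4 0 2 (by decide) hbd).elim (hrs _ _ hae) (hrs _ _ hce)

theorem cover_of_kneser_rule {n : ℕ} {r s : Fin n → Fin n → Prop} (hn : 5 ≤ n)
    (hr : ∀ a b, r a b → r b a) (hs : ∀ a b, s a b → s b a) (hrs : ∀ a b, r a b → ¬ s a b)
    (hrule : ∀ a b c d e, [a, b, c, d, e].Nodup → r a b → r c d ∨ r c e)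
    (hrule' : ∀ a b c d e, [a, b, c, d, e].Nodup → s a b → s c d ∨ s c e)
    {a b a' b' : Fin n} (hab : a ≠ b) (h : r a b) (hab' : a' ≠ b') (h' : s a' b') :
    (∀ x y, x ≠ y → r x y ∨ s x y) ∧ ∃ i j k, i ≠ j ∧ i ≠ k ∧ j ≠ k ∧ r i j ∧ s i k := by
  have hex : ∃ i j k, i ≠ j ∧ i ≠ k ∧ j ≠ k ∧ r i j ∧ s i k := by
    have share : ∀ i j k, i ≠ j → i ≠ k → r i j → s i k →
        ∃ i j k, i ≠ j ∧ i ≠ k ∧ j ≠ k ∧ r i j ∧ s i k := fun i j k hij hik h h' =>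
      ⟨i, j, k, hij, hik, fun e => hrs _ _ h (e ▸ h'), h, h'⟩
    by_cases h₁ : a = a'
    · subst h₁
      exact share _ _ _ hab hab' h h'
    by_cases h₂ : a = b'
    · subst h₂
      exact share _ _ _ hab hab'.symm h (hs _ _ h')
    by_cases h₃ : b = a'
    · subst h₃
      exact share _ _ _ hab.symm hab' (hr _ _ h) h'
    by_cases h₄ : b = b'
    · subst h₄
      exact share _ _ _ hab.symm hab'.symm (hr _ _ h) (hs _ _ h')
    -- For disjoint pairs, the rule with a fifth node moves `r` to a pair at `a'`, where it meets `s
    -- a' b'`.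
    obtain ⟨e, hea, heb, hea', heb'⟩ := Fin.exists_ne_four hn a b a' b'
    have := hrule a b a' b' e (by
      simp only [List.nodup_cons, List.mem_cons, List.not_mem_nil, or_false, not_or, not_false_eq_true,
        List.nodup_nil, and_true]
      exact ⟨⟨hab, h₁, h₂, hea.symm⟩, ⟨h₃, h₄, heb.symm⟩, ⟨hab', hea'.symm⟩, heb'.symm⟩) h
    exact share a' e b' hea'.symm hab' (this.resolve_left fun h => hrs _ _ h h') h'
  refine ⟨?_, hex⟩
  obtain ⟨a, b, c, hab, hac, hbc, h, h'⟩ := hex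
  -- Any two nodes can be completed to five nodes containing `a`, `b`, `c`, so the case of five
  -- nodes decides every pair.
  have five : ∀ d e, d ≠ a → d ≠ b → d ≠ c → e ≠ a → e ≠ b → e ≠ c → d ≠ e →
      (r d e ∨ s d e) ∧ (r b c ∨ s b c) ∧ (r a d ∨ s a d) ∧ (r b d ∨ s b d) ∧ (r c d ∨ s c d) := by
    intro d e hda hdb hdc hea heb hec hde
    have hf : Function.Injective ![a, b, c, d, e] := by
      rw [← List.nodup_ofFn]
      simp [hab, hac, hbc, hda.symm, hdb.symm, hdc.symm, hea.symm, heb.symm, hec.symm, hde]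
    exact cover_of_kneser_rule_five (r := fun x y => r (![a, b, c, d, e] x) (![a, b, c, d, e] y))
      (s := fun x y => s (![a, b, c, d, e] x) (![a, b, c, d, e] y)) (fun _ _ => hr _ _)
      (fun _ _ => hs _ _) (fun _ _ => hrs _ _) (fun _ _ _ _ _ h => hrule _ _ _ _ _ (h.map hf))
      (fun _ _ _ _ _ h => hrule' _ _ _ _ _ (h.map hf)) h h'
  obtain ⟨d, hda, hdb, hdc, -⟩ := Fin.exists_ne_four hn a b c c
  obtain ⟨e, hea, heb, hec, hed⟩ := Fin.exists_ne_four hn a b c d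
  have hcol : ∀ d, d ≠ a → d ≠ b → d ≠ c → (r a d ∨ s a d) ∧ (r b d ∨ s b d) ∧ (r c d ∨ s c d) := by
    intro x hxa hxb hxc
    obtain ⟨y, hya, hyb, hyc, hyx⟩ := Fin.exists_ne_four hn a b c x
    exact (five x y hxa hxb hxc hya hyb hyc hyx.symm).2.2
  have hsymm : ∀ {x y}, r x y ∨ s x y → r y x ∨ s y x := fun h => h.imp (hr _ _) (hs _ _)
  have hbc' := (five d e hda hdb hdc hea heb hec hed.symm).2.1
  intro x y hxy
  by_cases hxa : x = a
  · subst hxa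
    by_cases hyb : y = b
    · exact hyb ▸ .inl h
    by_cases hyc : y = c
    · exact hyc ▸ .inr h'
    · exact (hcol y hxy.symm hyb hyc).1
  by_cases hxb : x = b
  · subst hxb
    by_cases hya : y = a
    · exact hya ▸ .inl (hr _ _ h)
    by_cases hyc : y = c
    · exact hyc ▸ hbc'
    · exact (hcol y hya hxy.symm hyc).2.1
  by_cases hxc : x = c
  · subst hxc
    by_cases hya : y = a
    · exact hya ▸ .inr (hs _ _ h')
    by_cases hyb : y = b
    · exact hyb ▸ hsymm hbc'
    · exact (hcol y hya hyb hxy.symm).2.2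
  have hx := hcol x hxa hxb hxc
  by_cases hya : y = a
  · exact hya ▸ hsymm hx.1
  by_cases hyb : y = b
  · exact hyb ▸ hsymm hx.2.1
  by_cases hyc : y = c
  · exact hyc ▸ hsymm hx.2.2
  · exact (five x y hxa hxb hxc hya hyb hyc hxy).1

end Rules

/-! ### Dyads as node pairs and the orbits of relabelling -/

namespace Dyad

variable {n : ℕ}

/-- The dyad of two distinct nodes. -/
def of (i j : Fin n) (h : i ≠ j) : Dyad n := ⟨s(i, j), by simpa using h⟩

theorem of_comm {i j : Fin n} (h : i ≠ j) : of i j h = of j i h.symm :=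
  Subtype.ext Sym2.eq_swap

theorem exists_eq_of (d : Dyad n) : ∃ i j h, d = of i j h := by
  obtain ⟨d, hd⟩ := d
  induction d using Sym2.ind with
  | _ i j => exact ⟨i, j, by simpa using hd, rfl⟩

theorem relabel_of (π : Equiv.Perm (Fin n)) {i j : Fin n} (h : i ≠ j) :
    (of i j h).relabel π = of (π i) (π j) (π.injective.ne h) := rfl

theorem of_eq_of_iff {i j k l : Fin n} {hij : i ≠ j} {hkl : k ≠ l} :
    of i j hij = of k l hkl ↔ i = k ∧ j = l ∨ i = l ∧ j = k := by
  simp [of, Subtype.ext_iff]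

theorem adj_of_iff {i j k l : Fin n} {hij : i ≠ j} {hkl : k ≠ l} :
    (incidenceGraph n).Adj (of i j hij) (of k l hkl) ↔
      i = k ∧ j ≠ l ∨ i = l ∧ j ≠ k ∨ j = k ∧ i ≠ l ∨ j = l ∧ i ≠ k := by
  rw [SimpleGraph.lineGraph_adj_iff_exists, Ne, of_eq_of_iff]
  have : (∃ v, v ∈ (of i j hij : Sym2 (Fin n)) ∧ v ∈ (of k l hkl : Sym2 (Fin n))) ↔
      i = k ∨ i = l ∨ j = k ∨ j = l := by
    simp only [of, Sym2.mem_iff]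
    constructor
    · rintro ⟨v, rfl | rfl, h | h⟩ <;> simp [h]
    · rintro (h | h | h | h)
      exacts [⟨i, by simp [h]⟩, ⟨i, by simp [h]⟩, ⟨j, by simp [h]⟩, ⟨j, by simp [h]⟩]
  rw [this]
  grind

theorem exists_of_adj {d e : Dyad n} (h : (incidenceGraph n).Adj d e) :
    ∃ i j k, ∃ (hij : i ≠ j) (hjk : j ≠ k), i ≠ k ∧ d = of i j hij ∧ e = of j k hjk := by
  obtain ⟨i, j, hij, rfl⟩ := d.exists_eq_of
  obtain ⟨k, l, hkl, rfl⟩ := e.exists_eq_of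
  rw [adj_of_iff] at h
  rcases h with ⟨rfl, h⟩ | ⟨rfl, h⟩ | ⟨rfl, h⟩ | ⟨rfl, h⟩
  · exact ⟨j, i, l, hij.symm, hkl, h, of_comm _, rfl⟩
  · exact ⟨j, i, k, hij.symm, hkl.symm, h, of_comm _, of_comm _⟩
  · exact ⟨i, j, l, hij, hkl, h, rfl, rfl⟩
  · exact ⟨i, j, k, hij, hkl.symm, h, rfl, of_comm _⟩

theorem exists_of_not_adj {d e : Dyad n} (hde : d ≠ e) (h : ¬ (incidenceGraph n).Adj d e) :
    ∃ i j k l, ∃ (hij : i ≠ j) (hkl : k ≠ l), i ≠ k ∧ i ≠ l ∧ j ≠ k ∧ j ≠ l ∧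
      d = of i j hij ∧ e = of k l hkl := by
  obtain ⟨i, j, hij, rfl⟩ := d.exists_eq_of
  obtain ⟨k, l, hkl, rfl⟩ := e.exists_eq_of
  rw [adj_of_iff] at h
  rw [Ne, of_eq_of_iff] at hde
  refine ⟨i, j, k, l, hij, hkl, ?_, ?_, ?_, ?_, rfl, rfl⟩ <;> grind

theorem exists_of_triple {u v w : Dyad n} (huv : (incidenceGraph n).Adj u v)
    (hvw : (incidenceGraph n).Adj v w) (huw : u ≠ w) (h : ¬ (incidenceGraph n).Adj u w) :
    ∃ i j k l, ∃ (hij : i ≠ j) (hjk : j ≠ k) (hkl : k ≠ l), i ≠ k ∧ i ≠ l ∧ j ≠ l ∧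
      u = of i j hij ∧ v = of j k hjk ∧ w = of k l hkl := by
  obtain ⟨i, j, k, hij, hjk, hik, rfl, rfl⟩ := exists_of_adj huv
  obtain ⟨p, q, hpq, rfl⟩ := w.exists_eq_of
  rw [adj_of_iff] at h hvw
  rw [Ne, of_eq_of_iff] at huw
  by_cases hkp : k = p
  · subst hkp
    exact ⟨i, j, k, q, hij, hjk, hpq, hik, by grind, by grind, rfl, rfl, rfl⟩
  · obtain rfl : k = q := by grind
    exact ⟨i, j, k, p, hij, hjk, hpq.symm, hik, by grind, by grind, rfl, rfl, of_comm _⟩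

/-- In the complement the outer dyads share a node and the middle one is disjoint from both, so five
nodes occur. -/
theorem exists_of_triple_compl {u v w : Dyad n} (huv : (incidenceGraph n)ᶜ.Adj u v)
    (hvw : (incidenceGraph n)ᶜ.Adj v w) (huw : u ≠ w) (h : ¬ (incidenceGraph n)ᶜ.Adj u w) :
    ∃ i j k l m, ∃ (hij : i ≠ j) (hjk : j ≠ k) (hlm : l ≠ m), [i, j, k, l, m].Nodup ∧
      u = of i j hij ∧ w = of j k hjk ∧ v = of l m hlm := by
  rw [SimpleGraph.compl_adj] at huv hvw h
  obtain ⟨i, j, k, hij, hjk, hik, rfl, rfl⟩ := exists_of_adj (not_not.1 fun h' => h ⟨huw, h'⟩)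
  obtain ⟨l, m, hlm, rfl⟩ := v.exists_eq_of
  rw [adj_of_iff, Ne, of_eq_of_iff] at huv hvw
  refine ⟨i, j, k, l, m, hij, hjk, hlm, ?_, rfl, rfl, rfl⟩
  simp only [List.nodup_cons, List.mem_cons, List.not_mem_nil, or_false, not_or, not_false_eq_true,
    List.nodup_nil, and_true]
  grind

theorem exists_perm {m : ℕ} {f g : Fin m → Fin n} (hf : Function.Injective f)
    (hg : Function.Injective g) : ∃ π : Equiv.Perm (Fin n), ∀ x, π (f x) = g x :=
  Equiv.Perm.exists_extending_pair f g hf hg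

theorem exists_relabel_of_adj {d e d' e' : Dyad n} (h : (incidenceGraph n).Adj d e)
    (h' : (incidenceGraph n).Adj d' e') :
    ∃ π : Equiv.Perm (Fin n), d.relabel π = d' ∧ e.relabel π = e' := by
  obtain ⟨i, j, k, hij, hjk, hik, rfl, rfl⟩ := exists_of_adj h
  obtain ⟨i', j', k', hij', hjk', hik', rfl, rfl⟩ := exists_of_adj h'
  obtain ⟨π, hπ⟩ := exists_perm (f := ![i, j, k]) (g := ![i', j', k'])
    (by rw [← List.nodup_ofFn]; simp [hij, hik, hjk])
    (by rw [← List.nodup_ofFn]; simp [hij', hik', hjk'])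
  have h₀ : π i = i' := hπ 0
  have h₁ : π j = j' := hπ 1
  have h₂ : π k = k' := hπ 2
  exact ⟨π, by simp only [relabel_of, h₀, h₁], by simp only [relabel_of, h₁, h₂]⟩

theorem exists_relabel_of_not_adj {d e d' e' : Dyad n} (hde : d ≠ e)
    (h : ¬ (incidenceGraph n).Adj d e) (hde' : d' ≠ e') (h' : ¬ (incidenceGraph n).Adj d' e') :
    ∃ π : Equiv.Perm (Fin n), d.relabel π = d' ∧ e.relabel π = e' := by
  obtain ⟨i, j, k, l, hij, hkl, hik, hil, hjk, hjl, rfl, rfl⟩ := exists_of_not_adj hde h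
  obtain ⟨i', j', k', l', hij', hkl', hik', hil', hjk', hjl', rfl, rfl⟩ :=
    exists_of_not_adj hde' h'
  obtain ⟨π, hπ⟩ := exists_perm (f := ![i, j, k, l]) (g := ![i', j', k', l'])
    (by rw [← List.nodup_ofFn]; simp [hij, hik, hil, hjk, hjl, hkl])
    (by rw [← List.nodup_ofFn]; simp [hij', hik', hil', hjk', hjl', hkl'])
  have h₀ : π i = i' := hπ 0
  have h₁ : π j = j' := hπ 1
  have h₂ : π k = k' := hπ 2
  have h₃ : π l = l' := hπ 3
  exact ⟨π, by simp only [relabel_of, h₀, h₁], by simp only [relabel_of, h₂, h₃]⟩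

theorem exists_relabel_triple {u v w u' v' w' : Dyad n} (huv : (incidenceGraph n).Adj u v)
    (hvw : (incidenceGraph n).Adj v w) (huw : u ≠ w) (h : ¬ (incidenceGraph n).Adj u w)
    (huv' : (incidenceGraph n).Adj u' v') (hvw' : (incidenceGraph n).Adj v' w') (huw' : u' ≠ w')
    (h' : ¬ (incidenceGraph n).Adj u' w') :
    ∃ π : Equiv.Perm (Fin n), u.relabel π = u' ∧ v.relabel π = v' ∧ w.relabel π = w' := by
  obtain ⟨i, j, k, l, hij, hjk, hkl, hik, hil, hjl, rfl, rfl, rfl⟩ :=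
    exists_of_triple huv hvw huw h
  obtain ⟨i', j', k', l', hij', hjk', hkl', hik', hil', hjl', rfl, rfl, rfl⟩ :=
    exists_of_triple huv' hvw' huw' h'
  obtain ⟨π, hπ⟩ := exists_perm (f := ![i, j, k, l]) (g := ![i', j', k', l'])
    (by rw [← List.nodup_ofFn]; simp [hij, hik, hil, hjk, hjl, hkl])
    (by rw [← List.nodup_ofFn]; simp [hij', hik', hil', hjk', hjl', hkl'])
  have h₀ : π i = i' := hπ 0
  have h₁ : π j = j' := hπ 1
  have h₂ : π k = k' := hπ 2
  have h₃ : π l = l' := hπ 3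
  exact ⟨π, by simp only [relabel_of, h₀, h₁], by simp only [relabel_of, h₁, h₂],
    by simp only [relabel_of, h₂, h₃]⟩

theorem exists_relabel_triple_compl {u v w u' v' w' : Dyad n}
    (huv : (incidenceGraph n)ᶜ.Adj u v) (hvw : (incidenceGraph n)ᶜ.Adj v w) (huw : u ≠ w)
    (h : ¬ (incidenceGraph n)ᶜ.Adj u w) (huv' : (incidenceGraph n)ᶜ.Adj u' v')
    (hvw' : (incidenceGraph n)ᶜ.Adj v' w') (huw' : u' ≠ w')
    (h' : ¬ (incidenceGraph n)ᶜ.Adj u' w') :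
    ∃ π : Equiv.Perm (Fin n), u.relabel π = u' ∧ v.relabel π = v' ∧ w.relabel π = w' := by
  obtain ⟨i, j, k, l, m, hij, hjk, hlm, hnd, rfl, rfl, rfl⟩ :=
    exists_of_triple_compl huv hvw huw h
  obtain ⟨i', j', k', l', m', hij', hjk', hlm', hnd', rfl, rfl, rfl⟩ :=
    exists_of_triple_compl huv' hvw' huw' h'
  obtain ⟨π, hπ⟩ := exists_perm (f := ![i, j, k, l, m]) (g := ![i', j', k', l', m'])
    (by rw [← List.nodup_ofFn]; simpa using hnd) (by rw [← List.nodup_ofFn]; simpa using hnd')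
  have h₀ : π i = i' := hπ 0
  have h₁ : π j = j' := hπ 1
  have h₂ : π k = k' := hπ 2
  have h₃ : π l = l' := hπ 3
  have h₄ : π m = m' := hπ 4
  exact ⟨π, by simp only [relabel_of, h₀, h₁], by simp only [relabel_of, h₃, h₄],
    by simp only [relabel_of, h₁, h₂]⟩

end Dyad

/-! ### The criterion for the incidence graph and its complement -/

namespace MixedGraph

open Dyad

variable {n : ℕ}

theorem exists_adj_incidenceGraph (hn : 4 ≤ n) {a b : Dyad n} (h : (incidenceGraph n).Adj a b) :
    ∃ c, (incidenceGraph n).Adj b c ∧ a ≠ c ∧ ¬ (incidenceGraph n).Adj a c := by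
  obtain ⟨i, j, k, hij, hjk, hik, rfl, rfl⟩ := exists_of_adj h
  obtain ⟨l, hli, hlj, hlk⟩ := Fin.exists_ne_three hn i j k
  refine ⟨of k l hlk.symm, ?_, ?_, ?_⟩
  · rw [adj_of_iff]; grind
  · rw [Ne, of_eq_of_iff]; grind
  · rw [adj_of_iff]; grind

theorem exists_adj_compl_incidenceGraph (hn : 5 ≤ n) {a b : Dyad n}
    (h : (incidenceGraph n)ᶜ.Adj a b) :
    ∃ c, (incidenceGraph n)ᶜ.Adj b c ∧ a ≠ c ∧ ¬ (incidenceGraph n)ᶜ.Adj a c := by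
  simp only [SimpleGraph.compl_adj] at h ⊢
  obtain ⟨i, j, k, l, hij, hkl, hik, hil, hjk, hjl, rfl, rfl⟩ := exists_of_not_adj h.1 h.2
  obtain ⟨m, hmi, hmj, hmk, hml⟩ := Fin.exists_ne_four hn i j k l
  refine ⟨of i m hmi.symm, ⟨?_, ?_⟩, ?_, ?_⟩
  · rw [Ne, of_eq_of_iff]; grind
  · rw [adj_of_iff]; grind
  · rw [Ne, of_eq_of_iff]; grind
  · rw [adj_of_iff, Ne, of_eq_of_iff]; grind

theorem exists_not_adj_incidenceGraph (hn : 4 ≤ n) (d : Dyad n) :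
    ∃ e, d ≠ e ∧ ¬ (incidenceGraph n).Adj d e := by
  obtain ⟨i, j, hij, rfl⟩ := d.exists_eq_of
  obtain ⟨k, hki, hkj, -⟩ := Fin.exists_ne_three hn i j j
  obtain ⟨l, hli, hlj, hlk⟩ := Fin.exists_ne_three hn i j k
  refine ⟨of k l hlk.symm, ?_, ?_⟩
  · rw [Ne, of_eq_of_iff]; grind
  · rw [adj_of_iff]; grind

theorem exists_not_adj_compl_incidenceGraph (hn : 5 ≤ n) (d : Dyad n) :
    ∃ e, d ≠ e ∧ ¬ (incidenceGraph n)ᶜ.Adj d e := by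
  obtain ⟨i, j, hij, rfl⟩ := d.exists_eq_of
  obtain ⟨k, hki, hkj, -⟩ := Fin.exists_ne_four hn i j j j
  refine ⟨of i k hki.symm, ?_, ?_⟩
  · rw [Ne, of_eq_of_iff]; grind
  · rw [SimpleGraph.compl_adj, adj_of_iff, Ne, of_eq_of_iff]; grind

/-- Two nodes form a dyad in `K`. -/
def Joined (K : Set (Dyad n)) (i j : Fin n) : Prop := ∃ h : i ≠ j, of i j h ∈ K

theorem Joined.symm {K : Set (Dyad n)} {i j : Fin n} (h : Joined K i j) : Joined K j i :=
  ⟨h.1.symm, of_comm h.1 ▸ h.2⟩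

theorem exists_joined {K : Set (Dyad n)} (hK : K.Nonempty) : ∃ i j, i ≠ j ∧ Joined K i j := by
  obtain ⟨d, hd⟩ := hK
  obtain ⟨i, j, hij, rfl⟩ := d.exists_eq_of
  exact ⟨i, j, hij, hij, hd⟩

theorem cover_incidenceGraph (hn : 4 ≤ n) {K K' : Set (Dyad n)} (hK : K.Nonempty)
    (hK' : K'.Nonempty) (hKK' : Disjoint K K') (h : IsTripleClosed (incidenceGraph n) K)
    (h' : IsTripleClosed (incidenceGraph n) K') :
    (∀ x, x ∈ K ∨ x ∈ K') ∧ ∃ u ∈ K, ∃ w ∈ K', u ≠ w ∧ ¬ (incidenceGraph n).Adj u w := by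
  have rule : ∀ {K : Set (Dyad n)}, IsTripleClosed (incidenceGraph n) K → ∀ a b c d, a ≠ b →
      a ≠ c → a ≠ d → b ≠ c → b ≠ d → c ≠ d → Joined K a b → Joined K a c ∨ Joined K b d := by
    intro K h a b c d hab hac had hbc hbd hcd hK
    -- The path c, a, b, d on the nodes is an unshielded triple with middle dyad `ab`.
    refine (h (of a c hac) (of a b hab) (of b d hbd) hK.2 ?_ ?_ ?_ ?_).imp (fun h => ⟨hac, h⟩)
      (fun h => ⟨hbd, h⟩)
    · rw [adj_of_iff]; grind
    · rw [adj_of_iff]; grind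
    · rw [Ne, of_eq_of_iff]; grind
    · rw [adj_of_iff]; grind
  obtain ⟨a, b, hab, hK⟩ := exists_joined hK
  obtain ⟨a', b', hab', hK'⟩ := exists_joined hK'
  obtain ⟨h₁, i, j, k, l, hij, hik, hil, hjk, hjl, hkl, h₂, h₃⟩ := cover_of_line_rule hn
    (fun _ _ => Joined.symm) (fun _ _ => Joined.symm)
    (fun _ _ h h' => Set.disjoint_left.1 hKK' h.2 h'.2) (rule h) (rule h') hab hK hab' hK'
  refine ⟨fun x => ?_, of i j hij, h₂.2, of k l hkl, h₃.2, ?_, ?_⟩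
  · obtain ⟨i, j, hij, rfl⟩ := x.exists_eq_of
    exact (h₁ i j hij).imp (fun h => h.2) (fun h => h.2)
  · rw [Ne, of_eq_of_iff]; grind
  · rw [adj_of_iff]; grind

theorem cover_compl_incidenceGraph (hn : 5 ≤ n) {K K' : Set (Dyad n)} (hK : K.Nonempty)
    (hK' : K'.Nonempty) (hKK' : Disjoint K K') (h : IsTripleClosed (incidenceGraph n)ᶜ K)
    (h' : IsTripleClosed (incidenceGraph n)ᶜ K') :
    (∀ x, x ∈ K ∨ x ∈ K') ∧ ∃ u ∈ K, ∃ w ∈ K', u ≠ w ∧ ¬ (incidenceGraph n)ᶜ.Adj u w := by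
  have rule : ∀ {K : Set (Dyad n)}, IsTripleClosed (incidenceGraph n)ᶜ K → ∀ a b c d e,
      [a, b, c, d, e].Nodup → Joined K a b → Joined K c d ∨ Joined K c e := by
    intro K h a b c d e hnd hK
    simp only [List.nodup_cons, List.mem_cons, List.not_mem_nil, or_false, not_or,
      not_false_eq_true, List.nodup_nil, and_true] at hnd
    obtain ⟨⟨hab, hac, had, hae⟩, ⟨hbc, hbd, hbe⟩, ⟨hcd, hce⟩, hde⟩ := hnd
    -- The dyads `cd` and `ce` share a node and are both disjoint from the middle dyad `ab`.
    refine (h (of c d hcd) (of a b hab) (of c e hce) hK.2 ?_ ?_ ?_ ?_).imp (fun h => ⟨hcd, h⟩)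
      (fun h => ⟨hce, h⟩)
    · rw [SimpleGraph.compl_adj, adj_of_iff, Ne, of_eq_of_iff]; grind
    · rw [SimpleGraph.compl_adj, adj_of_iff, Ne, of_eq_of_iff]; grind
    · rw [Ne, of_eq_of_iff]; grind
    · rw [SimpleGraph.compl_adj, adj_of_iff, Ne, of_eq_of_iff]; grind
  obtain ⟨a, b, hab, hK⟩ := exists_joined hK
  obtain ⟨a', b', hab', hK'⟩ := exists_joined hK'
  obtain ⟨h₁, i, j, k, hij, hik, hjk, h₂, h₃⟩ := cover_of_kneser_rule hn
    (fun _ _ => Joined.symm) (fun _ _ => Joined.symm)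
    (fun _ _ h h' => Set.disjoint_left.1 hKK' h.2 h'.2) (rule h) (rule h') hab hK hab' hK'
  refine ⟨fun x => ?_, of i j hij, h₂.2, of i k hik, h₃.2, ?_, ?_⟩
  · obtain ⟨i, j, hij, rfl⟩ := x.exists_eq_of
    exact (h₁ i j hij).imp (fun h => h.2) (fun h => h.2)
  · rw [Ne, of_eq_of_iff]; grind
  · rw [SimpleGraph.compl_adj, adj_of_iff, Ne, of_eq_of_iff]; grind

variable {G : MixedGraph (Dyad n)}

/-- Relabelling of the nodes as a permutation of the dyads. -/
def relabelEquiv (π : Equiv.Perm (Fin n)) : Dyad n ≃ Dyad n :=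
  (SimpleGraph.Iso.completeGraph π).mapEdgeSet

/-- The independence model of `G` is invariant under relabelling of the nodes. -/
def IsInvariant (G : MixedGraph (Dyad n)) : Prop :=
  ∀ (π : Equiv.Perm (Fin n)) (C : Set (Dyad n)) (u w : Dyad n), u ≠ w → u ∉ C → w ∉ C →
    ¬ G.Conn C u w → ¬ G.Conn (relabelEquiv π '' C) (u.relabel π) (w.relabel π)

theorem IsInvariant.insepGraph_adj (hG : G.IsInvariant) {π : Equiv.Perm (Fin n)} {u w : Dyad n}
    (huw : u ≠ w) (h : G.insepGraph.Adj (u.relabel π) (w.relabel π)) : G.insepGraph.Adj u w := by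
  refine ⟨huw, fun D hu hw => ?_⟩
  by_contra hD
  refine hG π D u w huw hu hw hD (h.2 _ ?_ ?_)
  · exact fun h => hu (((relabelEquiv π).injective.mem_set_image (a := u)).1 h)
  · exact fun h => hw (((relabelEquiv π).injective.mem_set_image (a := w)).1 h)

theorem IsInvariant.not_conn_compl (hG : G.IsInvariant) (π : Equiv.Perm (Fin n)) {u w : Dyad n}
    (huw : u ≠ w) (h : ¬ G.Conn {u, w}ᶜ u w) :
    ¬ G.Conn {u.relabel π, w.relabel π}ᶜ (u.relabel π) (w.relabel π) := by
  have := hG π _ u w huw (by simp) (by simp) h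
  rwa [Set.image_compl_eq (relabelEquiv π).bijective, Set.image_pair] at this

theorem IsInvariant.exists_not_conn (hG : G.IsInvariant) (π : Equiv.Perm (Fin n))
    {u v w : Dyad n} (huw : u ≠ w) (h : ∃ E, v ∈ E ∧ u ∉ E ∧ w ∉ E ∧ ¬ G.Conn E u w) :
    ∃ E, v.relabel π ∈ E ∧ u.relabel π ∉ E ∧ w.relabel π ∉ E ∧
      ¬ G.Conn E (u.relabel π) (w.relabel π) := by
  obtain ⟨E, hv, hu, hw, hE⟩ := h
  refine ⟨_, Set.mem_image_of_mem (relabelEquiv π) hv, ?_, ?_, hG π E u w huw hu hw hE⟩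
  · exact fun h => hu (((relabelEquiv π).injective.mem_set_image (a := u)).1 h)
  · exact fun h => hw (((relabelEquiv π).injective.mem_set_image (a := w)).1 h)

/-- Pairs of distinct dyads have at most two orbits, adjacent and non-adjacent in the incidence
graph; each orbit is inseparable as a whole or not at all. -/
theorem IsInvariant.insepGraph_eq (hG : G.IsInvariant) :
    G.insepGraph = ⊥ ∨ G.insepGraph = incidenceGraph n ∨ G.insepGraph = (incidenceGraph n)ᶜ ∨
      G.insepGraph = ⊤ := by
  have h₁ : ∀ {d e d' e'}, (incidenceGraph n).Adj d e → G.insepGraph.Adj d e →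
      (incidenceGraph n).Adj d' e' → G.insepGraph.Adj d' e' := by
    intro d e d' e' h hI h'
    obtain ⟨π, rfl, rfl⟩ := exists_relabel_of_adj h' h
    exact hG.insepGraph_adj h'.ne hI
  have h₂ : ∀ {d e d' e'}, ¬ (incidenceGraph n).Adj d e → G.insepGraph.Adj d e → d' ≠ e' →
      ¬ (incidenceGraph n).Adj d' e' → G.insepGraph.Adj d' e' := by
    intro d e d' e' h hI hne h'
    obtain ⟨π, rfl, rfl⟩ := exists_relabel_of_not_adj hne h' hI.ne h
    exact hG.insepGraph_adj hne hI
  by_cases hL : ∃ d e, (incidenceGraph n).Adj d e ∧ G.insepGraph.Adj d e <;>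
    by_cases hC : ∃ d e, ¬ (incidenceGraph n).Adj d e ∧ G.insepGraph.Adj d e
  · obtain ⟨d, e, hL, hI⟩ := hL
    obtain ⟨d', e', hC, hI'⟩ := hC
    refine .inr (.inr (.inr ?_))
    ext x y
    rw [SimpleGraph.top_adj]
    refine ⟨fun h => h.ne, fun h => ?_⟩
    by_cases hxy : (incidenceGraph n).Adj x y
    · exact h₁ hL hI hxy
    · exact h₂ hC hI' h hxy
  · obtain ⟨d, e, hL, hI⟩ := hL
    refine .inr (.inl ?_)
    ext x y
    exact ⟨fun h => not_not.1 fun h' => hC ⟨x, y, h', h⟩, h₁ hL hI⟩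
  · obtain ⟨d, e, hC, hI⟩ := hC
    refine .inr (.inr (.inl ?_))
    ext x y
    rw [SimpleGraph.compl_adj]
    exact ⟨fun h => ⟨h.ne, fun h' => hL ⟨x, y, h', h⟩⟩, fun h => h₂ hC hI h.1 h.2⟩
  · refine .inl ?_
    ext x y
    rw [SimpleGraph.bot_adj, iff_false]
    intro h
    by_cases hxy : (incidenceGraph n).Adj x y
    · exact hL ⟨x, y, hxy, h⟩
    · exact hC ⟨x, y, hxy, h⟩

theorem IsInvariant.markovEquivalent_incidenceGraph (hG : G.IsChain) (hG' : G.IsInvariant)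
    (h : G.insepGraph = incidenceGraph n) :
    G.MarkovEquivalent (undirected (incidenceGraph n)) ∨
      G.MarkovEquivalent (bidirected (incidenceGraph n)) := by
  by_cases hn : 4 ≤ n
  · refine markovEquivalent_undirected_or_bidirected hG h ?_ ?_
      (fun _ _ => exists_adj_incidenceGraph hn) (exists_not_adj_incidenceGraph hn)
      (fun _ _ => cover_incidenceGraph hn)
    · intro u w u' w' huw hadj huw' hadj' hN
      obtain ⟨π, rfl, rfl⟩ := exists_relabel_of_not_adj huw hadj huw' hadj'
      exact hG'.not_conn_compl π huw hN
    · intro u v w u' v' w' huv hvw huw hadj huv' hvw' huw' hadj' hE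
      obtain ⟨π, rfl, rfl, rfl⟩ := exists_relabel_triple huv hvw huw hadj huv' hvw' huw' hadj'
      exact hG'.exists_not_conn π huw hE
  -- With fewer than four nodes there are no disjoint dyads, hence no separable pairs.
  · refine .inl (h ▸ markovEquivalent_undirected hG fun u w huw hadj => absurd ?_ hn)
    rw [h] at hadj
    obtain ⟨i, j, k, l, hij, hkl, hik, hil, hjk, hjl, -, -⟩ := exists_of_not_adj huw hadj
    have hf : Function.Injective ![i, j, k, l] := by
      rw [← List.nodup_ofFn]
      simp [hij, hik, hil, hjk, hjl, hkl]
    simpa using Fintype.card_le_of_injective _ hf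

theorem IsInvariant.markovEquivalent_compl_incidenceGraph (hG : G.IsChain) (hG' : G.IsInvariant)
    (h : G.insepGraph = (incidenceGraph n)ᶜ) :
    G.MarkovEquivalent (undirected (incidenceGraph n)ᶜ) ∨
      G.MarkovEquivalent (bidirected (incidenceGraph n)ᶜ) := by
  by_cases hn : 5 ≤ n
  · refine markovEquivalent_undirected_or_bidirected hG h ?_ ?_
      (fun _ _ => exists_adj_compl_incidenceGraph hn) (exists_not_adj_compl_incidenceGraph hn)
      (fun _ _ => cover_compl_incidenceGraph hn)
    · intro u w u' w' huw hadj huw' hadj' hN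
      have key : ∀ {d e : Dyad n}, d ≠ e → ¬ (incidenceGraph n)ᶜ.Adj d e →
          (incidenceGraph n).Adj d e := by
        intro d e hde h
        by_contra h'
        exact h ((SimpleGraph.compl_adj _ _ _).2 ⟨hde, h'⟩)
      obtain ⟨π, rfl, rfl⟩ := exists_relabel_of_adj (key huw hadj) (key huw' hadj')
      exact hG'.not_conn_compl π huw hN
    · intro u v w u' v' w' huv hvw huw hadj huv' hvw' huw' hadj' hE
      obtain ⟨π, rfl, rfl, rfl⟩ :=
        exists_relabel_triple_compl huv hvw huw hadj huv' hvw' huw' hadj'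
      exact hG'.exists_not_conn π huw hE
  -- With fewer than five nodes a dyad is disjoint from at most one other, so the complement is a
  -- matching and separable dyads are never connected.
  · refine .inl (h ▸ markovEquivalent_undirected hG fun u w huw hadj =>
      not_conn_of_forall_adj_adj (fun a b c hab hbc => ?_) huw hadj)
    rw [h, SimpleGraph.compl_adj] at hab hbc
    by_contra hac
    obtain ⟨i, j, k, l, hij, hkl, hik, hil, hjk, hjl, rfl, rfl⟩ := exists_of_not_adj hab.1 hab.2
    obtain ⟨p, q, hpq, rfl⟩ := c.exists_eq_of
    have hbc₁ := hbc.1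
    have hbc₂ := hbc.2
    rw [Ne, of_eq_of_iff] at hbc₁
    rw [of_eq_of_iff] at hac
    rw [adj_of_iff] at hbc₂
    -- A dyad disjoint from `kl` and different from `ij` contains a fifth node.
    have : ∃ m, m ≠ i ∧ m ≠ j ∧ m ≠ k ∧ m ≠ l := by
      by_cases hp : p = i ∨ p = j
      · exact ⟨q, by grind⟩
      · exact ⟨p, by grind⟩
    obtain ⟨m, hmi, hmj, hmk, hml⟩ := this
    have hf : Function.Injective ![i, j, k, l, m] := by
      rw [← List.nodup_ofFn]
      simp [hij, hik, hil, hjk, hjl, hkl, hmi.symm, hmj.symm, hmk.symm, hml.symm]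
    exact hn (by simpa using Fintype.card_le_of_injective _ hf)

end MixedGraph

theorem mainTheorem6 (n : ℕ) (P : MeasureTheory.Measure (Dyad n → Bool))
    [MeasureTheory.IsProbabilityMeasure P] (hP : IsExchangeable P)
    (G : MixedGraph (Dyad n)) (hG : G.IsChain) (hPG : IsFaithful P G) :
    G.MarkovEquivalent (MixedGraph.undirected ⊥) ∨
    G.MarkovEquivalent (MixedGraph.undirected (incidenceGraph n)) ∨
    G.MarkovEquivalent (MixedGraph.bidirected (incidenceGraph n)) ∨
    G.MarkovEquivalent (MixedGraph.undirected (incidenceGraph n)ᶜ) ∨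
    G.MarkovEquivalent (MixedGraph.bidirected (incidenceGraph n)ᶜ) ∨
    G.MarkovEquivalent (MixedGraph.undirected ⊤) := by
  have hinv : G.IsInvariant := fun π C u w huw hu hw h =>
    hPG.not_conn_image (MixedGraph.relabelEquiv π) (hP π) huw hu hw h
  rcases hinv.insepGraph_eq with h | h | h | h
  · refine .inl (h ▸ MixedGraph.markovEquivalent_undirected hG fun u w huw hadj =>
      MixedGraph.not_conn_of_forall_adj_adj (fun a b c hab _ => ?_) huw hadj)
    rw [h] at hab
    exact hab.elim
  · rcases MixedGraph.IsInvariant.markovEquivalent_incidenceGraph hG hinv h with h | h <;>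
      simp [h]
  · rcases MixedGraph.IsInvariant.markovEquivalent_compl_incidenceGraph hG hinv h with h | h <;>
      simp [h]
  · refine .inr (.inr (.inr (.inr (.inr (h ▸
      MixedGraph.markovEquivalent_undirected hG fun u w huw hadj => ?_)))))
    rw [h] at hadj
    exact absurd huw hadj
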